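/- **Machine.** Values $v_\ell$ carry a label $\ell$ from a lattice $\mathcal L$ with least element $\mathsf{public}$; an operand is a register or a labelled value, and operations label their result with the join of the labels of their operands. A configuration $C=(\rho,\mu,n,\mathit{buf},\sigma)$ consists of a register map $\rho$, a memory $\mu$ (instructions at program points, which are never overwritten, and labelled data at data addresses), the current program point $n$, a reorder buffer $\mathit{buf}$ and a return stack buffer $\sigma$ (finite partial maps on $\mathbb N$). $C$ is *initial* (equivalently *terminal*) if $\mathit{buf}=\emptyset$. Instructions are: operations, conditional branches, loads, stores, indirect jumps, direct calls, returns (calls and returns keep the return addresses on a stack in memory, through a stack pointer register; a return uses a dedicated temporary register), and speculation fences. A step $C\hookrightarrow_d^{o}C'$ is chosen by an attacker directive $d$ and emits a list $o$ of observations: * *fetch*, possibly with a guessed branch outcome or jump target, appends the transient form of the instruction at $n$ to $\mathit{buf}$ (a call: a marker, the unresolved stack pointer update, the store of the public return address; a return: a marker, the load of the return address, the stack pointer update, an indirect jump to the top of $\sigma$ or, if there is none, to a guessed target), updates $\sigma$ for calls and returns, and moves $n$ to the next or predicted program point; * *execute $i$* resolves the entry at index $i$, in any order, provided that no fence is pending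 before $i$; registers are read from the latest earlier assignment in $\mathit{buf}$, or else from $\rho$. Branches and indirect jumps emit $\mathsf{jump}\ n_\ell$ ($\ell$ the join of the operand labels); after a wrong guess the younger entries are removed (rollback). A load takes its value from the latest earlier store in $\mathit{buf}$ resolved to the same address (emitting $\mathsf{fwd}\ a_{\ell}$) or, if there is none, from memory (emitting $\mathsf{read}\ a_{\ell}$), where $\ell$ is the join of the labels of the address operands; it may also, on a guess, first be forwarded the value of an arbitrary earlier store, which is checked when its address is resolved. Store values and store addresses are resolved separately, the latter emitting $\mathsf{fwd}\ a_{\ell}$. When a load turns out to have used a value from the wrong place, the instruction of the load and everything younger is removed and fetched again (rollback); * *retire* removes the oldest, fully resolved instruction from $\mathit{buf}$ (calls and returns as a whole) and commits it to $\rho$ and $\mu$; stores and calls emit $\mathsf{write}\ a_{\ell}$. Rollbacks also emit the unlabelled observation $\mathsf{rollback}$. Write $C\Downarrow^{N}_{D,O}C'$ if the sequence (schedule) $D$ of directives leads from $C$ to $C'$ with concatenated trace $O$ and contains exactly $N$ retire directives. Such an execution is *sequential* if $C$ is initial, $C'$ is terminal, and every fetched instruction is executed and retired before a further instruction is fetched.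 An observation *carries* the label $\ell$ if its address or jump target is labelled $\ell$. **Theorem (Label stability and secrecy).** Let $C$ be an initial configuration whose program does not use the dedicated temporary register of returns as an operand, and let $\ell\in\mathcal L$. Suppose that $C\Downarrow^{N}_{D_1,O_1}C_1$ and no observation in $O_1$ carries $\ell$. Then 1. there is a sequential execution $C\Downarrow^{N}_{D_2,O_2}C_2$ (with the same number $N$ of retired instructions) such that no observation in $O_2$ carries $\ell$; 2. for every sequential execution $C\Downarrow^{N'}_{D_2,O_2}C_2$ with $N'\le N$, no observation in $O_2$ carries $\ell$. In particular, for $\ell=\mathsf{secret}$: if a speculative execution of $C$ that retires $N$ instructions produces a trace without $\mathsf{secret}$ labels, then the sequential execution of $C$ up to $N$ retired instructions never produces a $\mathsf{secret}$ label. -/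

import Mathlib

namespace Spec

/-! ### Finite partial maps on `ℕ` (reorder buffer, return stack buffer) -/

/-- A partial map from `ℕ` to `T` with finite domain. -/
structure FMap (T : Type*) where
  get : ℕ → Option T
  finite : {i | get i ≠ none}.Finite

namespace FMap

variable {T : Type*}

/-- The empty mapping. -/
def empty : FMap T := ⟨fun _ => none, by simp⟩

/-- The domain. -/
noncomputable def dom (m : FMap T) : Finset ℕ := m.finite.toFinset

/-- `m[i ↦ t]`. -/
def set (m : FMap T) (i : ℕ) (t : T) : FMap T :=
  ⟨Function.update m.get i (some t), by
    refine (m.finite.union (Set.finite_singleton i)).subset ?_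
    intro j hj
    by_cases h : j = i
    · exact Or.inr h
    · left
      simpa [Function.update_of_ne h] using hj⟩

/-- The restriction of `m` to the indices satisfying `p`. -/
def restrict (m : FMap T) (p : ℕ → Prop) [DecidablePred p] : FMap T :=
  ⟨fun j => if p j then m.get j else none, by
    refine m.finite.subset ?_
    intro j hj
    by_cases h : p j
    · simpa [h] using hj
    · simp [h] at hj⟩

/-- `m[j : j < i]`. -/
def below (m : FMap T) (i : ℕ) : FMap T := m.restrict (fun j => j < i)

/-- `m[j : j > i]`. -/
def above (m : FMap T) (i : ℕ) : FMap T := m.restrict (fun j => i < j)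

/-- `m` with `i` removed from its domain. -/
def erase (m : FMap T) (i : ℕ) : FMap T := m.restrict (fun j => j ≠ i)

/-- The largest index in the domain, `0` for the empty map. -/
noncomputable def maxIdx (m : FMap T) : ℕ := m.dom.sup id

/-- The smallest index in the domain, `0` for the empty map. -/
noncomputable def minIdx (m : FMap T) : ℕ := sInf {i | m.get i ≠ none}

end FMap

/-! ### Values, instructions, directives, observations

`V` is the type of values (data, data addresses and program points), `L` the lattice of security
labels with least element `⊥` (the label `public`), `R` the type of register names and `Op` the
type of opcodes. -/

/-- A labelled value `v_ℓ`. -/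
@[ext]
structure LVal (V L : Type*) where
  val : V
  lab : L

/-- The join of the labels of a list of labelled values. -/
def joinLab {V L : Type*} [Lattice L] [OrderBot L] (vs : List (LVal V L)) : L :=
  (vs.map LVal.lab).foldr (· ⊔ ·) ⊥

/-- An operand is a register or a labelled value. -/
inductive Operand (R V L : Type*) where
  | reg (r : R)
  | val (v : LVal V L)

/-- Physical instructions. `next` is the following program point. -/
inductive Instr (R V L Op : Type*) where
  | op (o : Op) (r : R) (args : List (Operand R V L)) (next : V)
  | br (o : Op) (args : List (Operand R V L)) (nTrue nFalse : V)
  | load (r : R) (args : List (Operand R V L)) (next : V)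
  | store (src : Operand R V L) (args : List (Operand R V L)) (next : V)
  | jmpi (args : List (Operand R V L))
  | call (nf nret : V)
  | ret
  | fence (next : V)

/-- The operands that an instruction mentions explicitly. -/
def Instr.operands {R V L Op : Type*} : Instr R V L Op → List (Operand R V L)
  | .op _ _ args _ => args
  | .br _ args _ _ => args
  | .load _ args _ => args
  | .store src args _ => src :: args
  | .jmpi args => args
  | .call _ _ => []
  | .ret => []
  | .fence _ => []

/-- Transient instructions. -/
inductive Transient (R V L Op : Type*) where
  /-- unresolved operation -/
  | op (r : R) (o : Op) (args : List (Operand R V L))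
  /-- resolved operation `r = v_ℓ` -/
  | value (r : R) (v : LVal V L)
  /-- unresolved conditional, speculated to continue at `guess` -/
  | br (o : Op) (args : List (Operand R V L)) (guess nTrue nFalse : V)
  /-- resolved conditional or indirect jump -/
  | jump (n : V)
  /-- unresolved load, fetched at program point `pt` -/
  | load (r : R) (args : List (Operand R V L)) (pt : V)
  /-- partially resolved load: `v` has been forwarded from the store at index `j` by a guess -/
  | loadGuess (r : R) (args : List (Operand R V L)) (v : LVal V L) (j : ℕ) (pt : V)
  /-- resolved load `r = v_ℓ{dep, a}`; `dep = ⊥` if the value was read from memory -/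
  | loaded (r : R) (v : LVal V L) (dep : WithBot ℕ) (a : V) (pt : V)
  /-- store; the value is resolved if `src` is a value, the address if `dst` is in `Sum.inr` -/
  | store (src : Operand R V L) (dst : List (Operand R V L) ⊕ LVal V L)
  /-- unresolved indirect jump, predicted to go to `guess` -/
  | jmpi (args : List (Operand R V L)) (guess : V)
  /-- marker in front of the entries of a call -/
  | call
  /-- marker in front of the entries of a return -/
  | ret
  | fence

/-- The register that a transient instruction assigns, if any. -/
def Transient.target {R V L Op : Type*} : Transient R V L Op → Option R
  | .op r _ _ => some r
  | .value r _ => some r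
  | .load r _ _ => some r
  | .loadGuess r _ _ _ _ => some r
  | .loaded r _ _ _ _ => some r
  | _ => none

/-- The value assigned to the target register, if it is available. -/
def Transient.result {R V L Op : Type*} : Transient R V L Op → Option (LVal V L)
  | .value _ v => some v
  | .loadGuess _ _ v _ _ => some v
  | .loaded _ v _ _ _ => some v
  | _ => none

/-- The transient instruction is a fully resolved assignment `r = v_ℓ` (of an operation or a
load). -/
inductive Transient.IsValue {R V L Op : Type*} : Transient R V L Op → R → LVal V L → Prop
  | value (r : R) (v : LVal V L) : IsValue (.value r v) r v
  | loaded (r : R) (v : LVal V L) (dep : WithBot ℕ) (a pt : V) : IsValue (.loaded r v dep a pt) r v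

/-- Commands recorded in the return stack buffer. -/
inductive RSBCmd (V : Type*) where
  | push (n : V)
  | pop

/-- The effect of a command on a stack (a list whose head is the top). -/
def RSBCmd.apply {V : Type*} (st : List V) : RSBCmd V → List V
  | .push n => n :: st
  | .pop => st.tail

/-- The value on top of the return stack: the commands are applied in the order of their indices,
starting with the empty stack. -/
noncomputable def rsbTop {V : Type*} (σ : FMap (RSBCmd V)) : Option V :=
  (((σ.dom.sort (· ≤ ·)).filterMap σ.get).foldl RSBCmd.apply []).head?

/-- Attacker directives. -/
inductive Directive (V : Type*) where
  | fetch
  | fetchBool (b : Bool)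
  | fetchTo (n : V)
  | exec (i : ℕ)
  | execFwd (i j : ℕ)
  | execValue (i : ℕ)
  | execAddr (i : ℕ)
  | retire

/-- Fetch directives, with or without a guess. -/
def Directive.isFetch {V : Type*} : Directive V → Bool
  | .fetch => true
  | .fetchBool _ => true
  | .fetchTo _ => true
  | _ => false

def Directive.isRetire {V : Type*} : Directive V → Bool
  | .retire => true
  | _ => false

/-- The number of retired instructions of a schedule. -/
def numRetired {V : Type*} (D : List (Directive V)) : ℕ := D.countP Directive.isRetire

/-- Observations. -/
inductive Obs (V L : Type*) where
  | read (a : LVal V L)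
  | fwd (a : LVal V L)
  | write (a : LVal V L)
  | jump (n : LVal V L)
  | rollback

/-- The observation `o` carries the label `ℓ`. -/
def Obs.Carries {V L : Type*} (ℓ : L) : Obs V L → Prop
  | .read a => a.lab = ℓ
  | .fwd a => a.lab = ℓ
  | .write a => a.lab = ℓ
  | .jump n => n.lab = ℓ
  | .rollback => False

/-! ### Machines and configurations -/

/-- The parameters of the semantics: evaluation of opcodes, of branch conditions and of addresses
on unlabelled values, the opcodes moving the stack pointer, the stack pointer and the temporary
register used by returns. -/
structure Machine (R V Op : Type*) where
  evalOp : Op → List V → Option V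
  evalCond : Op → List V → Option Bool
  addr : List V → Option V
  succ : Op
  pred : Op
  rsp : R
  rret : R
  rret_ne_rsp : rret ≠ rsp

/-- A program: the part of memory that maps program points to instructions. -/
abbrev Program (R V L Op : Type*) := V → Option (Instr R V L Op)

/-- Configurations: registers, data memory, current program point, reorder buffer and return
stack buffer. -/
structure Config (R V L Op : Type*) where
  reg : R → Option (LVal V L)
  mem : V → Option (LVal V L)
  pc : V
  buf : FMap (Transient R V L Op)
  rsb : FMap (RSBCmd V)

namespace Config

variable {R V L Op : Type*}

/-- The index of the next fetched instruction. -/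
noncomputable def fresh (C : Config R V L Op) : ℕ := C.buf.maxIdx + 1

/-- `i` is the oldest index of the buffer. -/
def Retirable (C : Config R V L Op) (i : ℕ) : Prop := C.buf.minIdx = i

/-- No fence is pending before index `i`. -/
def NoFence (C : Config R V L Op) (i : ℕ) : Prop := ∀ j < i, C.buf.get j ≠ some .fence

/-- The entry at index `j` assigns register `r`. -/
def Assigns (C : Config R V L Op) (j : ℕ) (r : R) : Prop :=
  ∃ t, C.buf.get j = some t ∧ t.target = some r

open Classical in
/-- The register resolve function: the value of `r` as seen by the instruction at index `i`. This
is the value of the latest assignment to `r` before `i`, undefined if that assignment has no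
value yet, and the value in the register map if there is no such assignment. -/
noncomputable def resolveReg (C : Config R V L Op) (i : ℕ) (r : R) : Option (LVal V L) :=
  if h : ∃ j, IsGreatest {j | j < i ∧ C.Assigns j r} j then
    (C.buf.get h.choose).bind Transient.result
  else C.reg r

/-- The register resolve function on operands. -/
noncomputable def resolve (C : Config R V L Op) (i : ℕ) : Operand R V L → Option (LVal V L)
  | .reg r => C.resolveReg i r
  | .val v => some v

/-- The operands `args` of the instruction at index `i` resolve to the values `vs`. -/
def Resolves (C : Config R V L Op) (i : ℕ) (args : List (Operand R V L))
    (vs : List (LVal V L)) : Prop :=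
  List.Forall₂ (fun rv v => C.resolve i rv = some v) args vs

/-- Operands `args` at index `i` evaluate to the labelled address `a`. -/
def ResolvesAddr [Lattice L] [OrderBot L] (M : Machine R V Op) (C : Config R V L Op) (i : ℕ)
    (args : List (Operand R V L)) (a : LVal V L) : Prop :=
  ∃ vs, C.Resolves i args vs ∧ M.addr (vs.map LVal.val) = some a.val ∧ a.lab = joinLab vs

/-- The entry at index `j` is a store whose address is resolved to `a`. -/
def StoreAt (C : Config R V L Op) (j : ℕ) (a : V) : Prop :=
  ∃ src b, C.buf.get j = some (.store src (.inr b)) ∧ b.val = a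

/-- Resolving the store at `i` to address `a` reveals that the resolved load at `k > i` obtained
its value from the wrong place. -/
def Hazard (C : Config R V L Op) (i : ℕ) (a : V) (k : ℕ) : Prop :=
  i < k ∧ ∃ r v dep b pt, C.buf.get k = some (.loaded r v dep b pt) ∧
    ((b = a ∧ dep < (i : WithBot ℕ)) ∨ (dep = (i : WithBot ℕ) ∧ b ≠ a))

open Classical in
/-- The first buffer index of the physical instruction to which the load at index `k` belongs: `k`
itself, or `k - 1` for the load of a return, which is preceded by the marker `ret`. -/
noncomputable def loadStart (C : Config R V L Op) (k : ℕ) : ℕ :=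
  if C.buf.get (k - 1) = some .ret then k - 1 else k

/-- Configuration after fetching a return with predicted return point `n`. -/
noncomputable def fetchRet (M : Machine R V Op) (C : Config R V L Op) (n : V) :
    Config R V L Op :=
  { C with
    pc := n
    buf := (((C.buf.set C.fresh .ret).set (C.fresh + 1) (.load M.rret [.reg M.rsp] C.pc)).set
      (C.fresh + 2) (.op M.rsp M.pred [.reg M.rsp])).set
      (C.fresh + 3) (.jmpi [.reg M.rret] n)
    rsb := C.rsb.set C.fresh .pop }

/-- Roll back to the buffer indices below `k` and continue at program point `n`. -/
def rollback (C : Config R V L Op) (k : ℕ) (n : V) : Config R V L Op :=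
  { C with pc := n, buf := C.buf.below k, rsb := C.rsb.below k }

/-- Replace the buffer entry at index `i`. -/
def setBuf (C : Config R V L Op) (i : ℕ) (t : Transient R V L Op) : Config R V L Op :=
  { C with buf := C.buf.set i t }

end Config

/-! ### Small-step semantics -/

/-- `Step M P C d O C'`: under directive `d`, configuration `C` steps to `C'` with observations
`O`. -/
inductive Step {R V L Op : Type*} [DecidableEq R] [DecidableEq V] [Lattice L] [OrderBot L]
    (M : Machine R V Op) (P : Program R V L Op) (C : Config R V L Op) :
    Directive V → List (Obs V L) → Config R V L Op → Prop
  -- fetch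
  | op_fetch (o : Op) (r : R) (args : List (Operand R V L)) (next : V)
      (hP : P C.pc = some (.op o r args next)) :
      Step M P C .fetch [] { C.setBuf C.fresh (.op r o args) with pc := next }
  | load_fetch (r : R) (args : List (Operand R V L)) (next : V)
      (hP : P C.pc = some (.load r args next)) :
      Step M P C .fetch [] { C.setBuf C.fresh (.load r args C.pc) with pc := next }
  | store_fetch (src : Operand R V L) (args : List (Operand R V L)) (next : V)
      (hP : P C.pc = some (.store src args next)) :
      Step M P C .fetch [] { C.setBuf C.fresh (.store src (.inl args)) with pc := next }
  | fence_fetch (next : V) (hP : P C.pc = some (.fence next)) :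
      Step M P C .fetch [] { C.setBuf C.fresh .fence with pc := next }
  | br_fetch (b : Bool) (o : Op) (args : List (Operand R V L)) (nT nF : V)
      (hP : P C.pc = some (.br o args nT nF)) :
      Step M P C (.fetchBool b) []
        { C.setBuf C.fresh (.br o args (if b then nT else nF) nT nF) with
          pc := if b then nT else nF }
  | jmpi_fetch (n : V) (args : List (Operand R V L)) (hP : P C.pc = some (.jmpi args)) :
      Step M P C (.fetchTo n) [] { C.setBuf C.fresh (.jmpi args n) with pc := n }
  | call_fetch (nf nret : V) (hP : P C.pc = some (.call nf nret)) :
      Step M P C .fetch []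
        { C with
          pc := nf
          buf := ((C.buf.set C.fresh .call).set (C.fresh + 1)
            (.op M.rsp M.succ [.reg M.rsp])).set (C.fresh + 2)
            (.store (.val ⟨nret, ⊥⟩) (.inl [.reg M.rsp]))
          rsb := C.rsb.set C.fresh (.push nret) }
  | ret_fetch_rsb (n : V) (hP : P C.pc = some .ret) (htop : rsbTop C.rsb = some n) :
      Step M P C .fetch [] (C.fetchRet M n)
  | ret_fetch_rsb_empty (n : V) (hP : P C.pc = some .ret) (htop : rsbTop C.rsb = none) :
      Step M P C (.fetchTo n) [] (C.fetchRet M n)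
  -- execute: operations
  | op_execute (i : ℕ) (r : R) (o : Op) (args : List (Operand R V L)) (vs : List (LVal V L))
      (v : V) (hi : C.buf.get i = some (.op r o args)) (hfence : C.NoFence i)
      (hvs : C.Resolves i args vs) (hv : M.evalOp o (vs.map LVal.val) = some v) :
      Step M P C (.exec i) [] (C.setBuf i (.value r ⟨v, joinLab vs⟩))
  -- execute: conditional branches
  | br_execute_correct (i : ℕ) (o : Op) (args : List (Operand R V L)) (guess nT nF : V)
      (vs : List (LVal V L)) (b : Bool)
      (hi : C.buf.get i = some (.br o args guess nT nF)) (hfence : C.NoFence i)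
      (hvs : C.Resolves i args vs) (hb : M.evalCond o (vs.map LVal.val) = some b)
      (hguess : (if b then nT else nF) = guess) :
      Step M P C (.exec i) [.jump ⟨guess, joinLab vs⟩] (C.setBuf i (.jump guess))
  | br_execute_incorrect (i : ℕ) (o : Op) (args : List (Operand R V L)) (guess nT nF : V)
      (vs : List (LVal V L)) (b : Bool) (n : V)
      (hi : C.buf.get i = some (.br o args guess nT nF)) (hfence : C.NoFence i)
      (hvs : C.Resolves i args vs) (hb : M.evalCond o (vs.map LVal.val) = some b)
      (hn : (if b then nT else nF) = n) (hguess : n ≠ guess) :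
      Step M P C (.exec i) [.rollback, .jump ⟨n, joinLab vs⟩]
        ((C.rollback i n).setBuf i (.jump n))
  -- execute: indirect jumps
  | jmpi_execute_correct (i : ℕ) (args : List (Operand R V L)) (guess : V) (n : LVal V L)
      (hi : C.buf.get i = some (.jmpi args guess)) (hfence : C.NoFence i)
      (hn : C.ResolvesAddr M i args n) (hguess : n.val = guess) :
      Step M P C (.exec i) [.jump n] (C.setBuf i (.jump guess))
  | jmpi_execute_incorrect (i : ℕ) (args : List (Operand R V L)) (guess : V) (n : LVal V L)
      (hi : C.buf.get i = some (.jmpi args guess)) (hfence : C.NoFence i)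
      (hn : C.ResolvesAddr M i args n) (hguess : n.val ≠ guess) :
      Step M P C (.exec i) [.rollback, .jump n] ((C.rollback i n.val).setBuf i (.jump n.val))
  -- execute: loads
  | load_execute_forward (i j : ℕ) (r : R) (args : List (Operand R V L)) (pt : V)
      (a b v : LVal V L)
      (hi : C.buf.get i = some (.load r args pt)) (hfence : C.NoFence i)
      (ha : C.ResolvesAddr M i args a)
      (hj : IsGreatest {k | k < i ∧ C.StoreAt k a.val} j)
      (hv : C.buf.get j = some (.store (.val v) (.inr b))) :
      Step M P C (.exec i) [.fwd a] (C.setBuf i (.loaded r v (j : WithBot ℕ) a.val pt))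
  | load_execute_nodep (i : ℕ) (r : R) (args : List (Operand R V L)) (pt : V)
      (a v : LVal V L)
      (hi : C.buf.get i = some (.load r args pt)) (hfence : C.NoFence i)
      (ha : C.ResolvesAddr M i args a)
      (hj : ∀ k < i, ¬ C.StoreAt k a.val) (hv : C.mem a.val = some v) :
      Step M P C (.exec i) [.read a] (C.setBuf i (.loaded r v ⊥ a.val pt))
  -- execute: loads with a guessed alias
  | load_execute_guess (i j : ℕ) (r : R) (args : List (Operand R V L)) (pt : V) (v : LVal V L)
      (dst : List (Operand R V L) ⊕ LVal V L)
      (hi : C.buf.get i = some (.load r args pt)) (hfence : C.NoFence i) (hji : j < i)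
      (hj : C.buf.get j = some (.store (.val v) dst)) :
      Step M P C (.execFwd i j) [] (C.setBuf i (.loadGuess r args v j pt))
  | load_execute_addr_ok (i j : ℕ) (r : R) (args : List (Operand R V L)) (pt : V)
      (a v : LVal V L) (dst : List (Operand R V L) ⊕ LVal V L)
      (hi : C.buf.get i = some (.loadGuess r args v j pt)) (hfence : C.NoFence i)
      (ha : C.ResolvesAddr M i args a)
      (hj : C.buf.get j = some (.store (.val v) dst)) (hdst : ∀ b, dst = .inr b → b.val = a.val)
      (hk : ∀ k, j < k → k < i → ¬ C.StoreAt k a.val) :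
      Step M P C (.exec i) [.fwd a] (C.setBuf i (.loaded r v (j : WithBot ℕ) a.val pt))
  | load_execute_addr_hazard (i j : ℕ) (r : R) (args : List (Operand R V L)) (pt : V)
      (a v : LVal V L)
      (hi : C.buf.get i = some (.loadGuess r args v j pt)) (hfence : C.NoFence i)
      (ha : C.ResolvesAddr M i args a)
      (hj : (∃ b, b ≠ a.val ∧ C.StoreAt j b) ∨ ∃ k, j < k ∧ k < i ∧ C.StoreAt k a.val) :
      Step M P C (.exec i) [.rollback, .fwd a] (C.rollback (C.loadStart i) pt)
  | load_execute_mem_match (i j : ℕ) (r : R) (args : List (Operand R V L)) (pt : V)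
      (a v : LVal V L)
      (hi : C.buf.get i = some (.loadGuess r args v j pt)) (hfence : C.NoFence i)
      (ha : C.ResolvesAddr M i args a)
      (hj : C.buf.get j = none) (hk : ∀ k < i, ¬ C.StoreAt k a.val)
      (hv : C.mem a.val = some v) :
      Step M P C (.exec i) [.read a] (C.setBuf i (.loaded r v ⊥ a.val pt))
  | load_execute_mem_hazard (i j : ℕ) (r : R) (args : List (Operand R V L)) (pt : V)
      (a v w : LVal V L)
      (hi : C.buf.get i = some (.loadGuess r args v j pt)) (hfence : C.NoFence i)
      (ha : C.ResolvesAddr M i args a)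
      (hj : C.buf.get j = none) (hk : ∀ k < i, ¬ C.StoreAt k a.val)
      (hw : C.mem a.val = some w) (hne : w ≠ v) :
      Step M P C (.exec i) [.rollback, .read a] (C.rollback (C.loadStart i) pt)
  -- execute: stores
  | store_execute_value (i : ℕ) (src : Operand R V L) (dst : List (Operand R V L) ⊕ LVal V L)
      (v : LVal V L)
      (hi : C.buf.get i = some (.store src dst)) (hfence : C.NoFence i)
      (hv : C.resolve i src = some v) :
      Step M P C (.execValue i) [] (C.setBuf i (.store (.val v) dst))
  | store_execute_addr_ok (i : ℕ) (src : Operand R V L) (args : List (Operand R V L))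
      (a : LVal V L)
      (hi : C.buf.get i = some (.store src (.inl args))) (hfence : C.NoFence i)
      (ha : C.ResolvesAddr M i args a) (hk : ∀ k, ¬ C.Hazard i a.val k) :
      Step M P C (.execAddr i) [.fwd a] (C.setBuf i (.store src (.inr a)))
  | store_execute_addr_hazard (i k : ℕ) (src : Operand R V L) (args : List (Operand R V L))
      (a : LVal V L) (r : R) (v : LVal V L) (dep : WithBot ℕ) (b pt : V)
      (hi : C.buf.get i = some (.store src (.inl args))) (hfence : C.NoFence i)
      (ha : C.ResolvesAddr M i args a) (hk : IsLeast {k | C.Hazard i a.val k} k)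
      (hload : C.buf.get k = some (.loaded r v dep b pt)) :
      Step M P C (.execAddr i) [.rollback, .fwd a]
        ((C.rollback (C.loadStart k) pt).setBuf i (.store src (.inr a)))
  -- retire
  | value_retire (i : ℕ) (t : Transient R V L Op) (r : R) (v : LVal V L)
      (hmin : C.Retirable i) (hi : C.buf.get i = some t) (ht : t.IsValue r v) :
      Step M P C .retire []
        { C with reg := Function.update C.reg r (some v), buf := C.buf.erase i }
  | jump_retire (i : ℕ) (n : V) (hmin : C.Retirable i) (hi : C.buf.get i = some (.jump n)) :
      Step M P C .retire [] { C with buf := C.buf.erase i }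
  | fence_retire (i : ℕ) (hmin : C.Retirable i) (hi : C.buf.get i = some .fence) :
      Step M P C .retire [] { C with buf := C.buf.erase i }
  | store_retire (i : ℕ) (v a : LVal V L) (hmin : C.Retirable i)
      (hi : C.buf.get i = some (.store (.val v) (.inr a))) :
      Step M P C .retire [.write a]
        { C with mem := Function.update C.mem a.val (some v), buf := C.buf.erase i }
  | call_retire (i : ℕ) (vsp v a : LVal V L) (hmin : C.Retirable i)
      (hi : C.buf.get i = some .call)
      (hi1 : C.buf.get (i + 1) = some (.value M.rsp vsp))
      (hi2 : C.buf.get (i + 2) = some (.store (.val v) (.inr a))) :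
      Step M P C .retire [.write a]
        { C with
          reg := Function.update C.reg M.rsp (some vsp)
          mem := Function.update C.mem a.val (some v)
          buf := C.buf.above (i + 2) }
  | ret_retire (i : ℕ) (t1 t2 : Transient R V L Op) (v1 v2 : LVal V L) (n : V)
      (hmin : C.Retirable i) (hi : C.buf.get i = some .ret)
      (hi1 : C.buf.get (i + 1) = some t1) (ht1 : t1.IsValue M.rret v1)
      (hi2 : C.buf.get (i + 2) = some t2) (ht2 : t2.IsValue M.rsp v2)
      (hi3 : C.buf.get (i + 3) = some (.jump n)) :
      Step M P C .retire []
        { C with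
          reg := Function.update C.reg M.rsp (some v2)
          buf := C.buf.above (i + 3) }

/-! ### Executions -/

/-- `Exec M P C D O C'`: executing the schedule `D` from `C` leads to `C'` with trace `O`. -/
inductive Exec {R V L Op : Type*} [DecidableEq R] [DecidableEq V] [Lattice L] [OrderBot L]
    (M : Machine R V Op) (P : Program R V L Op) :
    Config R V L Op → List (Directive V) → List (Obs V L) → Config R V L Op → Prop
  | nil (C : Config R V L Op) : Exec M P C [] [] C
  | cons {C C' C'' : Config R V L Op} {d : Directive V} {D : List (Directive V)}
      {O O' : List (Obs V L)} (h : Step M P C d O C') (h' : Exec M P C' D O' C'') :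
      Exec M P C (d :: D) (O ++ O') C''

/-- Initial (equivalently, terminal) configurations: nothing is in flight. -/
def Config.Idle {R V L Op : Type*} (C : Config R V L Op) : Prop := C.buf = FMap.empty

/-- A schedule is sequential for `C` if at every fetch all previously fetched instructions have
already been executed and retired, i.e. the reorder buffer is empty. -/
def IsSequential {R V L Op : Type*} [DecidableEq R] [DecidableEq V] [Lattice L] [OrderBot L]
    (M : Machine R V Op) (P : Program R V L Op) (C : Config R V L Op)
    (D : List (Directive V)) : Prop :=
  ∀ (D₁ D₂ : List (Directive V)) (d : Directive V) (O : List (Obs V L)) (C' : Config R V L Op),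
    D = D₁ ++ d :: D₂ → d.isFetch = true → Exec M P C D₁ O C' → C'.Idle

/-- Sequential executions: they start in an initial configuration, end in a terminal one, and
follow a sequential schedule. -/
def SeqExec {R V L Op : Type*} [DecidableEq R] [DecidableEq V] [Lattice L] [OrderBot L]
    (M : Machine R V Op) (P : Program R V L Op) (C : Config R V L Op)
    (D : List (Directive V)) (O : List (Obs V L)) (C' : Config R V L Op) : Prop :=
  C.Idle ∧ IsSequential M P C D ∧ Exec M P C D O C' ∧ C'.Idle

/-- The register `r` is not an explicit operand of any instruction of the program. -/
def Program.NotRead {R V L Op : Type*} (P : Program R V L Op) (r : R) : Prop :=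
  ∀ n ins, P n = some ins → Operand.reg r ∉ ins.operands

end Spec

/-!
Every execution is compared with a machine that executes the program in order, without a buffer, and
exposes in each step the set of labels of the addresses and jump targets of the instruction. A ghost
state records the entries in flight as they were fetched, with mispredicted targets corrected, and
the labels exposed by resolving them. Every step preserves the invariant that a resolved entry holds
the value determined by the older entries as far as they are known. Hence retiring an instruction is
a step of the in-order machine, and the labels of that step were all observed while the instruction
was in flight.

The in-order machine is deterministic, so a sequential execution that retires at most as many
instructions follows a prefix of the same run. With a single instruction in flight no load can use a
wrong value, and a misprediction leaves the mispredicted entry in place; so every label observed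
belongs to an instruction that is eventually retired, and there are no others. Conversely, every
in-order run is realized by fetching, executing and retiring one instruction at a time.
-/

namespace Spec

variable {R V L Op : Type*}

/-! ### Finite maps -/

namespace FMap

variable {T : Type*}

theorem ext_get {m m' : FMap T} (h : ∀ i, m.get i = m'.get i) : m = m' := by
  cases m; cases m'
  simpa only [mk.injEq] using funext h

theorem get_set (m : FMap T) (i j : ℕ) (t : T) :
    (m.set i t).get j = if j = i then some t else m.get j :=
  Function.update_apply _ _ _ _

theorem get_below (m : FMap T) (i j : ℕ) :
    (m.below i).get j = if j < i then m.get j else none := rfl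

theorem get_above (m : FMap T) (i j : ℕ) :
    (m.above i).get j = if i < j then m.get j else none := rfl

theorem get_erase (m : FMap T) (i j : ℕ) :
    (m.erase i).get j = if j ≠ i then m.get j else none := rfl

theorem mem_dom {m : FMap T} {i : ℕ} : i ∈ m.dom ↔ m.get i ≠ none := by
  simp [dom]

theorem maxIdx_empty : (empty : FMap T).maxIdx = 0 := by
  have hdom : (empty : FMap T).dom = ∅ := by
    ext i
    simp [mem_dom, empty]
  simp [maxIdx, hdom]

theorem maxIdx_add_one {m : FMap T} {b e : ℕ} (hbe : b < e)
    (h : ∀ k, m.get k ≠ none ↔ b ≤ k ∧ k < e) : m.maxIdx + 1 = e := by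
  have upper : m.maxIdx ≤ e - 1 := Finset.sup_le fun k hk =>
    Nat.le_sub_one_of_lt ((h k).1 (mem_dom.1 hk)).2
  have lower : e - 1 ≤ m.maxIdx :=
    Finset.le_sup (f := id) (mem_dom.2 ((h (e - 1)).2 ⟨by omega, by omega⟩))
  omega

theorem minIdx_eq {m : FMap T} {b : ℕ} (hb : m.get b ≠ none)
    (h : ∀ k, m.get k ≠ none → b ≤ k) : m.minIdx = b :=
  IsLeast.csInf_eq ⟨hb, h⟩

end FMap

/-! ### Operand evaluation -/

/-- The value of an operand under a register assignment. -/
def evalOperand (f : R → Option (LVal V L)) : Operand R V L → Option (LVal V L)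
  | .reg r => f r
  | .val v => some v

/-- Under the register assignment `f`, the partial operation `F` on unlabelled values applied to
the operands `args` yields `v`, labelled with the join of the labels of the operands. Opcodes,
branch conditions and address computations are all instances. -/
def EvalTo [Lattice L] [OrderBot L] (F : List V → Option V) (f : R → Option (LVal V L))
    (args : List (Operand R V L)) (v : LVal V L) : Prop :=
  ∃ vs, args.map (evalOperand f) = vs.map some ∧ F (vs.map LVal.val) = some v.val ∧
    v.lab = joinLab vs

theorem evalOperand_mono {f g : R → Option (LVal V L)} {x : Operand R V L}
    (hfg : ∀ r, x = .reg r → ∀ v, f r = some v → g r = some v) {v : LVal V L}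
    (h : evalOperand f x = some v) : evalOperand g x = some v := by
  cases x with
  | reg r => exact hfg r rfl v h
  | val w => exact h

namespace EvalTo

variable [Lattice L] [OrderBot L] {F : List V → Option V} {f g : R → Option (LVal V L)}
  {args : List (Operand R V L)} {v w : LVal V L}

theorem functional (hv : EvalTo F f args v) (hw : EvalTo F f args w) : v = w := by
  obtain ⟨vs, hvs, hv, hvlab⟩ := hv
  obtain ⟨ws, hws, hw, hwlab⟩ := hw
  obtain rfl := List.map_injective_iff.2 (Option.some_injective _) (hvs.symm.trans hws)
  exact LVal.ext (Option.some.inj (hv.symm.trans hw)) (hvlab.trans hwlab.symm)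

theorem mono (h : EvalTo F f args v)
    (hfg : ∀ r, .reg r ∈ args → ∀ v, f r = some v → g r = some v) : EvalTo F g args v := by
  obtain ⟨vs, hvs, h⟩ := h
  refine ⟨vs, (List.map_congr_left fun x hx => ?_).trans hvs, h⟩
  obtain ⟨w, -, hw⟩ := List.mem_map.1 (hvs ▸ List.mem_map_of_mem hx)
  rw [← hw, evalOperand_mono (fun r hr => hfg r (hr ▸ hx)) hw.symm]

theorem reg_iff_val {r : R} (hr : f r = some v) :
    EvalTo F f [.reg r] w ↔ EvalTo F g [.val v] w := by
  simp only [EvalTo, List.map_cons, List.map_nil, evalOperand, hr]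

end EvalTo

/-- The target of a conditional branch, as a function of the values of its operands. -/
def Machine.branchTarget (M : Machine R V Op) (o : Op) (nTrue nFalse : V) (vs : List V) :
    Option V :=
  (M.evalCond o vs).map fun b => if b then nTrue else nFalse

/-! ### Register resolution -/

open Classical in
/-- The register assignment `f` updated by the transient instruction `t`; the target register
becomes undefined as long as `t` has no result. -/
noncomputable def Transient.assign (f : R → Option (LVal V L)) (t : Transient R V L Op) (r : R) :
    Option (LVal V L) :=
  if t.target = some r then t.result else f r

theorem Transient.assign_of_target_eq_none (f : R → Option (LVal V L))
    {t : Transient R V L Op} (ht : t.target = none) : t.assign f = f := by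
  funext r
  simp [assign, ht]

theorem Transient.assign_of_target_eq_some [DecidableEq R] (f : R → Option (LVal V L))
    {t : Transient R V L Op} {r : R} (ht : t.target = some r) :
    t.assign f = Function.update f r t.result := by
  funext r'
  simp [assign, ht, Function.update_apply, eq_comm]

theorem Transient.IsValue.target_eq {t : Transient R V L Op} {r : R} {v : LVal V L}
    (h : t.IsValue r v) : t.target = some r := by
  cases h <;> rfl

theorem Transient.IsValue.result_eq {t : Transient R V L Op} {r : R} {v : LVal V L}
    (h : t.IsValue r v) : t.result = some v := by
  cases h <;> rfl

/-- A buffer entry may advance from `t` to `t'` during execution: the target register is kept, and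
so are the result and the value of a store once they are known. -/
structure Transient.Advances (t t' : Transient R V L Op) : Prop where
  target : t'.target = t.target
  result : ∀ v, t.result = some v → t'.result = some v
  storeValue : ∀ v dst, t = .store (.val v) dst → ∃ dst', t' = .store (.val v) dst'

theorem Transient.Advances.refl (t : Transient R V L Op) : t.Advances t :=
  ⟨rfl, fun _ h => h, fun _ dst h => ⟨dst, h⟩⟩

namespace Config

variable {C C' : Config R V L Op} {b i : ℕ}

theorem resolve_eq (C : Config R V L Op) (i : ℕ) (x : Operand R V L) :
    C.resolve i x = evalOperand (C.resolveReg i) x := by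
  cases x <;> rfl

theorem resolves_iff {args : List (Operand R V L)} {vs : List (LVal V L)} :
    C.Resolves i args vs ↔ args.map (evalOperand (C.resolveReg i)) = vs.map some := by
  simp [Resolves, resolve_eq, ← List.forall₂_eq_eq_eq]

theorem Resolves.evalTo [Lattice L] [OrderBot L] {args : List (Operand R V L)}
    {vs : List (LVal V L)} (h : C.Resolves i args vs) {F : List V → Option V} {v : V}
    (hv : F (vs.map LVal.val) = some v) : EvalTo F (C.resolveReg i) args ⟨v, joinLab vs⟩ :=
  ⟨vs, resolves_iff.1 h, hv, rfl⟩

theorem resolvesAddr_iff [Lattice L] [OrderBot L] {M : Machine R V Op}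
    {args : List (Operand R V L)} {a : LVal V L} :
    C.ResolvesAddr M i args a ↔ EvalTo M.addr (C.resolveReg i) args a := by
  simp only [ResolvesAddr, EvalTo, resolves_iff]

theorem resolveReg_zero (C : Config R V L Op) : C.resolveReg 0 = C.reg := by
  funext r
  exact dif_neg fun ⟨_, hj⟩ => Nat.not_lt_zero _ hj.1.1

theorem resolveReg_succ_of_assigns {r : R} (h : C.Assigns i r) :
    C.resolveReg (i + 1) r = (C.buf.get i).bind Transient.result := by
  have greatest : IsGreatest {j | j < i + 1 ∧ C.Assigns j r} i :=
    ⟨⟨Nat.lt_succ_self i, h⟩, fun j hj => Nat.lt_succ_iff.1 hj.1⟩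
  have hex : ∃ j, IsGreatest {j | j < i + 1 ∧ C.Assigns j r} j := ⟨i, greatest⟩
  rw [resolveReg, dif_pos hex, hex.choose_spec.unique greatest]

theorem resolveReg_succ_of_not_assigns {r : R} (h : ¬ C.Assigns i r) :
    C.resolveReg (i + 1) r = C.resolveReg i r := by
  have candidates : {j | j < i + 1 ∧ C.Assigns j r} = {j | j < i ∧ C.Assigns j r} := by
    ext j
    exact and_congr_left fun hj => ⟨fun hji => by grind, fun hji => by omega⟩
  rw [resolveReg, resolveReg, candidates]

theorem resolveReg_succ (C : Config R V L Op) (i : ℕ) :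
    C.resolveReg (i + 1) = (C.buf.get i).elim (C.resolveReg i) (·.assign (C.resolveReg i)) := by
  funext r
  by_cases h : C.Assigns i r
  · rw [resolveReg_succ_of_assigns h]
    obtain ⟨t, ht, hr⟩ := h
    simp [ht, Transient.assign, hr]
  · rw [resolveReg_succ_of_not_assigns h]
    cases ht : C.buf.get i with
    | none => rfl
    | some t => exact (if_neg fun hr => h ⟨t, ht, hr⟩).symm

theorem resolveReg_succ_of_get {t : Transient R V L Op} (h : C.buf.get i = some t) :
    C.resolveReg (i + 1) = t.assign (C.resolveReg i) := by
  rw [resolveReg_succ, h]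
  rfl

theorem resolveReg_congr (hreg : C'.reg = C.reg) (h : ∀ j < i, C'.buf.get j = C.buf.get j) :
    C'.resolveReg i = C.resolveReg i := by
  induction i with
  | zero => rw [resolveReg_zero, resolveReg_zero, hreg]
  | succ i ih => rw [resolveReg_succ, resolveReg_succ, h i i.lt_succ_self,
      ih fun j hj => h j (hj.trans i.lt_succ_self)]

theorem resolveReg_eq_reg (h : ∀ j < i, C.buf.get j = none) : C.resolveReg i = C.reg := by
  induction i with
  | zero => exact resolveReg_zero C
  | succ i ih =>
    rw [resolveReg_succ, h i i.lt_succ_self, Option.elim_none,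
      ih fun j hj => h j (hj.trans i.lt_succ_self)]

theorem resolveReg_mono {r : R} {v : LVal V L} (hbi : b ≤ i)
    (hbase : (∀ j, b ≤ j → j < i → ¬ C.Assigns j r) →
      ∀ v, C.resolveReg b r = some v → C'.resolveReg b r = some v)
    (hbuf : ∀ j, b ≤ j → j < i →
      ∃ t t', C.buf.get j = some t ∧ C'.buf.get j = some t' ∧ t.Advances t')
    (h : C.resolveReg i r = some v) : C'.resolveReg i r = some v := by
  induction i, hbi using Nat.le_induction with
  | base => exact hbase (fun j hj hj' => absurd hj hj'.not_ge) v h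
  | succ i hbi ih =>
    obtain ⟨t, t', ht, ht', hadv⟩ := hbuf i hbi i.lt_succ_self
    rw [resolveReg_succ_of_get ht, Transient.assign] at h
    rw [resolveReg_succ_of_get ht', Transient.assign, hadv.target]
    split_ifs at h ⊢ with hr
    · exact hadv.result v h
    · refine ih (fun hn => hbase fun j hj hji => ?_) (fun j hj hji => hbuf j hj (by omega)) h
      rcases Nat.lt_succ_iff_lt_or_eq.1 hji with hji | rfl
      · exact hn j hj hji
      · simpa [Assigns, ht] using hr

end Config

/-! ### Labels of traces -/

/-- The labels carried by the observations of a trace. -/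
def obsLabels (O : List (Obs V L)) : Set L := {l | ∃ o ∈ O, o.Carries l}

@[simp] theorem obsLabels_nil : obsLabels ([] : List (Obs V L)) = ∅ := by
  simp [obsLabels]

@[simp] theorem obsLabels_append (O O' : List (Obs V L)) :
    obsLabels (O ++ O') = obsLabels O ∪ obsLabels O' := by
  ext l
  simp [obsLabels, or_and_right, exists_or]

@[simp] theorem obsLabels_rollback (O : List (Obs V L)) :
    obsLabels (.rollback :: O) = obsLabels O := by
  simp [obsLabels, Obs.Carries]

@[simp] theorem obsLabels_read (a : LVal V L) : obsLabels [.read a] = {a.lab} := by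
  ext l; simp [obsLabels, Obs.Carries, eq_comm]

@[simp] theorem obsLabels_fwd (a : LVal V L) : obsLabels [.fwd a] = {a.lab} := by
  ext l; simp [obsLabels, Obs.Carries, eq_comm]

@[simp] theorem obsLabels_write (a : LVal V L) : obsLabels [.write a] = {a.lab} := by
  ext l; simp [obsLabels, Obs.Carries, eq_comm]

@[simp] theorem obsLabels_jump (a : LVal V L) : obsLabels [.jump a] = {a.lab} := by
  ext l; simp [obsLabels, Obs.Carries, eq_comm]

/-! ### The in-order machine -/

/-- States of the in-order machine: registers, data memory and program point. -/
structure ArchState (R V L : Type*) where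
  reg : R → Option (LVal V L)
  mem : V → Option (LVal V L)
  pc : V

section Arch

variable [DecidableEq R] [DecidableEq V] [Lattice L] [OrderBot L] {M : Machine R V Op}
  {P : Program R V L Op} {s s₁ s₂ : ArchState R V L} {n₁ n₂ : ℕ} {T₁ T₂ A₁ A₂ : Set L}

/-- `ArchEffect M s ins T s'`: in-order execution of the instruction `ins` takes `s` to `s'` and
exposes the labels `T` of its addresses and jump targets. -/
inductive ArchEffect (M : Machine R V Op) (s : ArchState R V L) :
    Instr R V L Op → Set L → ArchState R V L → Prop
  | op {o : Op} {r : R} {args : List (Operand R V L)} {next : V} {v : LVal V L}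
      (hv : EvalTo (M.evalOp o) s.reg args v) :
      ArchEffect M s (.op o r args next) ∅ ⟨Function.update s.reg r (some v), s.mem, next⟩
  | br {o : Op} {args : List (Operand R V L)} {nT nF : V} {n : LVal V L}
      (hn : EvalTo (M.branchTarget o nT nF) s.reg args n) :
      ArchEffect M s (.br o args nT nF) {n.lab} ⟨s.reg, s.mem, n.val⟩
  | load {r : R} {args : List (Operand R V L)} {next : V} {a v : LVal V L}
      (ha : EvalTo M.addr s.reg args a) (hv : s.mem a.val = some v) :
      ArchEffect M s (.load r args next) {a.lab} ⟨Function.update s.reg r (some v), s.mem, next⟩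
  | store {src : Operand R V L} {args : List (Operand R V L)} {next : V} {a v : LVal V L}
      (ha : EvalTo M.addr s.reg args a) (hv : evalOperand s.reg src = some v) :
      ArchEffect M s (.store src args next) {a.lab}
        ⟨s.reg, Function.update s.mem a.val (some v), next⟩
  | jmpi {args : List (Operand R V L)} {n : LVal V L} (hn : EvalTo M.addr s.reg args n) :
      ArchEffect M s (.jmpi args) {n.lab} ⟨s.reg, s.mem, n.val⟩
  | call {nf nret : V} {sp a : LVal V L} (hsp : EvalTo (M.evalOp M.succ) s.reg [.reg M.rsp] sp)
      (ha : EvalTo M.addr s.reg [.val sp] a) :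
      ArchEffect M s (.call nf nret) {a.lab}
        ⟨Function.update s.reg M.rsp (some sp), Function.update s.mem a.val (some ⟨nret, ⊥⟩), nf⟩
  | ret {a w sp n : LVal V L} (ha : EvalTo M.addr s.reg [.reg M.rsp] a)
      (hw : s.mem a.val = some w) (hsp : EvalTo (M.evalOp M.pred) s.reg [.reg M.rsp] sp)
      (hn : EvalTo M.addr s.reg [.val w] n) :
      ArchEffect M s .ret {a.lab, n.lab} ⟨Function.update s.reg M.rsp (some sp), s.mem, n.val⟩
  | fence {next : V} : ArchEffect M s (.fence next) ∅ ⟨s.reg, s.mem, next⟩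

theorem ArchEffect.functional {ins : Instr R V L Op} (h₁ : ArchEffect M s ins T₁ s₁)
    (h₂ : ArchEffect M s ins T₂ s₂) : T₁ = T₂ ∧ s₁ = s₂ := by
  cases h₁ with
  | op hv =>
    cases h₂ with | op hv' =>
    obtain rfl := hv.functional hv'
    exact ⟨rfl, rfl⟩
  | br hv =>
    cases h₂ with | br hv' =>
    obtain rfl := hv.functional hv'
    exact ⟨rfl, rfl⟩
  | load ha hv =>
    cases h₂ with | load ha' hv' =>
    obtain rfl := ha.functional ha'
    cases hv.symm.trans hv'
    exact ⟨rfl, rfl⟩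
  | store ha hv =>
    cases h₂ with | store ha' hv' =>
    obtain rfl := ha.functional ha'
    cases hv.symm.trans hv'
    exact ⟨rfl, rfl⟩
  | jmpi hv =>
    cases h₂ with | jmpi hv' =>
    obtain rfl := hv.functional hv'
    exact ⟨rfl, rfl⟩
  | call hsp ha =>
    cases h₂ with | call hsp' ha' =>
    obtain rfl := hsp.functional hsp'
    obtain rfl := ha.functional ha'
    exact ⟨rfl, rfl⟩
  | ret ha hw hsp hn =>
    cases h₂ with | ret ha' hw' hsp' hn' =>
    obtain rfl := ha.functional ha'
    cases hw.symm.trans hw'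
    obtain rfl := hsp.functional hsp'
    obtain rfl := hn.functional hn'
    exact ⟨rfl, rfl⟩
  | fence =>
    cases h₂
    exact ⟨rfl, rfl⟩

/-- A step of the in-order machine: the instruction at the current program point is executed. -/
def ArchStep (M : Machine R V Op) (P : Program R V L Op) (s : ArchState R V L) (T : Set L)
    (s' : ArchState R V L) : Prop :=
  ∃ ins, P s.pc = some ins ∧ ArchEffect M s ins T s'

theorem ArchStep.functional (h₁ : ArchStep M P s T₁ s₁) (h₂ : ArchStep M P s T₂ s₂) :
    T₁ = T₂ ∧ s₁ = s₂ := by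
  obtain ⟨ins, hP, h₁⟩ := h₁
  obtain ⟨ins', hP', h₂⟩ := h₂
  cases hP.symm.trans hP'
  exact h₁.functional h₂

/-- A run of `n` steps of the in-order machine, with the labels that it exposes. -/
inductive ArchRun (M : Machine R V Op) (P : Program R V L Op) :
    ArchState R V L → ℕ → Set L → ArchState R V L → Prop
  | nil (s : ArchState R V L) : ArchRun M P s 0 ∅ s
  | cons {s s₁ s₂ : ArchState R V L} {n : ℕ} {T A : Set L} (h : ArchStep M P s T s₁)
      (h' : ArchRun M P s₁ n A s₂) : ArchRun M P s (n + 1) (T ∪ A) s₂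

namespace ArchRun

theorem single (h : ArchStep M P s T₁ s₁) : ArchRun M P s 1 T₁ s₁ := by
  simpa using ArchRun.cons h (.nil s₁)

theorem append (h₁ : ArchRun M P s n₁ A₁ s₁) (h₂ : ArchRun M P s₁ n₂ A₂ s₂) :
    ArchRun M P s (n₁ + n₂) (A₁ ∪ A₂) s₂ := by
  induction h₁ with
  | nil => simpa using h₂
  | cons h _ ih =>
    rw [Set.union_assoc, Nat.add_right_comm]
    exact .cons h (ih h₂)

theorem functional (h₁ : ArchRun M P s n₁ A₁ s₁) (h₂ : ArchRun M P s n₁ A₂ s₂) :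
    A₁ = A₂ ∧ s₁ = s₂ := by
  induction h₁ generalizing A₂ with
  | nil s =>
    cases h₂
    exact ⟨rfl, rfl⟩
  | cons h _ ih =>
    cases h₂ with | cons h' h₂ =>
    obtain ⟨rfl, rfl⟩ := h.functional h'
    obtain ⟨rfl, rfl⟩ := ih h₂
    exact ⟨rfl, rfl⟩

theorem labels_subset (h₁ : ArchRun M P s n₁ A₁ s₁) (h₂ : ArchRun M P s n₂ A₂ s₂)
    (hn : n₁ ≤ n₂) : A₁ ⊆ A₂ := by
  induction h₁ generalizing n₂ A₂ with
  | nil s => exact Set.empty_subset _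
  | cons h _ ih =>
    cases h₂ with
    | nil => omega
    | cons h' h₂ =>
      obtain ⟨rfl, rfl⟩ := h.functional h'
      exact Set.union_subset_union_right _ (ih h₂ (by omega))

end ArchRun

end Arch

/-! ### Changes of the reorder buffer -/

namespace Config

/-- `C'` arises from `C` by replacing the buffer entry `t` at index `i` by `t'` and removing the
entries from index `limit` on. -/
structure Replaced (C : Config R V L Op) (i limit : ℕ) (t t' : Transient R V L Op)
    (C' : Config R V L Op) : Prop where
  old : C.buf.get i = some t
  lt : i < limit
  get : ∀ k, C'.buf.get k = if k = i then some t' else if k < limit then C.buf.get k else none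
  reg : C'.reg = C.reg
  mem : C'.mem = C.mem

namespace Replaced

variable {C C' : Config R V L Op} {i k limit : ℕ} {t t' : Transient R V L Op}

theorem get_self (h : C.Replaced i limit t t' C') : C'.buf.get i = some t' := by
  rw [h.get, if_pos rfl]

theorem get_of_ne (h : C.Replaced i limit t t' C') (hki : k ≠ i) (hk : k < limit) :
    C'.buf.get k = C.buf.get k := by
  rw [h.get, if_neg hki, if_pos hk]

theorem setBuf (hi : C.buf.get i = some t) (hlt : i < limit)
    (hlimit : ∀ k, limit ≤ k → C.buf.get k = none) : C.Replaced i limit t t' (C.setBuf i t') where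
  old := hi
  lt := hlt
  get k := by
    rw [Config.setBuf, FMap.get_set]
    split_ifs with hki hk
    · rfl
    · rfl
    · exact hlimit k (not_lt.1 hk)
  reg := rfl
  mem := rfl

theorem rollback (hi : C.buf.get i = some t) (hlt : i < limit) (m : V) :
    C.Replaced i limit t t' ((C.rollback limit m).setBuf i t') where
  old := hi
  lt := hlt
  get k := by rw [Config.setBuf, FMap.get_set, Config.rollback, FMap.get_below]
  reg := rfl
  mem := rfl

theorem rollback_self (hi : C.buf.get i = some t) (m : V) :
    C.Replaced i (i + 1) t t' ((C.rollback i m).setBuf i t') where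
  old := hi
  lt := i.lt_succ_self
  get k := by
    rw [Config.setBuf, FMap.get_set, Config.rollback, FMap.get_below]
    split_ifs <;> first | rfl | omega
  reg := rfl
  mem := rfl

theorem exists_advances (h : C.Replaced i limit t t' C') (hadv : t.Advances t')
    {u : Transient R V L Op} (hk : k < limit) (hu : C.buf.get k = some u) :
    ∃ u', C'.buf.get k = some u' ∧ u.Advances u' := by
  by_cases hki : k = i
  · subst hki
    cases hu.symm.trans h.old
    exact ⟨t', h.get_self, hadv⟩
  · exact ⟨u, (h.get_of_ne hki hk).trans hu, .refl u⟩

end Replaced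

/-- `C'` arises from `C` by removing the buffer entries below `m` and committing them to the
registers and the memory; the value of the temporary register `M.rret` is not kept. -/
structure Commits (M : Machine R V Op) (C : Config R V L Op) (m : ℕ) (C' : Config R V L Op) :
    Prop where
  pc : C'.pc = C.pc
  get : ∀ k, C'.buf.get k = if m ≤ k then C.buf.get k else none
  reg : ∀ r ≠ M.rret, C'.reg r = C.resolveReg m r
  store : ∀ j < m, ∀ src dst, C.buf.get j = some (.store src dst) →
    ∃ v a, src = .val v ∧ dst = .inr a ∧ C'.mem a.val = some v
  mem : ∀ a, C'.mem a ≠ C.mem a → ∃ j < m, C.StoreAt j a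

end Config

/-! ### Consistency of buffer entries -/

/-- The value `v` of the resolved load at index `k` from address `a` is the one determined by the
stores before `k` whose addresses are known. If the store at index `dep` has been retired in the
meantime, then its value is found in memory. -/
structure LoadConsistent (C : Config R V L Op) (k : ℕ) (v : LVal V L) (dep : WithBot ℕ) (a : V) :
    Prop where
  dep_lt : dep < (k : WithBot ℕ)
  le_dep : ∀ j < k, C.StoreAt j a → (j : WithBot ℕ) ≤ dep
  source : (∃ (j : ℕ) (dst : List (Operand R V L) ⊕ LVal V L),
      dep = (j : WithBot ℕ) ∧ C.buf.get j = some (.store (.val v) dst) ∧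
        ∀ b, dst = .inr b → b.val = a) ∨
    ((∀ j : ℕ, (j : WithBot ℕ) ≤ dep → C.buf.get j = none) ∧ C.mem a = some v)

namespace LoadConsistent

variable {C C' : Config R V L Op} {i k m limit : ℕ} {v : LVal V L} {dep : WithBot ℕ} {a : V}

theorem transfer (h : LoadConsistent C k v dep a) (hmem : C'.mem = C.mem)
    (hnone : ∀ j < k, C.buf.get j = none → C'.buf.get j = none)
    (haddr : ∀ j < k, C'.StoreAt j a → (j : WithBot ℕ) ≤ dep ∨ C.StoreAt j a)
    (hval : ∀ j < k, dep = (j : WithBot ℕ) → ∀ dst, C.buf.get j = some (.store (.val v) dst) →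
      (∀ b, dst = .inr b → b.val = a) →
      ∃ dst', C'.buf.get j = some (.store (.val v) dst') ∧ ∀ b, dst' = .inr b → b.val = a) :
    LoadConsistent C' k v dep a where
  dep_lt := h.dep_lt
  le_dep j hj hs := (haddr j hj hs).elim id (h.le_dep j hj)
  source := by
    rcases h.source with ⟨j, dst, rfl, hj, hdst⟩ | ⟨hbuf, hv⟩
    · obtain ⟨dst', hj', hdst'⟩ := hval j (WithBot.coe_lt_coe.1 h.dep_lt) rfl dst hj hdst
      exact .inl ⟨j, dst', rfl, hj', hdst'⟩
    · exact .inr ⟨fun j hj => hnone j (WithBot.coe_lt_coe.1 (hj.trans_lt h.dep_lt)) (hbuf j hj),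
        hmem ▸ hv⟩

theorem congr (h : LoadConsistent C k v dep a) (hmem : C'.mem = C.mem)
    (hbuf : ∀ j < k, C'.buf.get j = C.buf.get j) : LoadConsistent C' k v dep a :=
  h.transfer hmem (fun j hj hn => (hbuf j hj).trans hn)
    (fun j hj hs => .inr (by simpa only [Config.StoreAt, hbuf j hj] using hs))
    fun j hj _ dst hs hdst => ⟨dst, (hbuf j hj).trans hs, hdst⟩

theorem replaced {t t' : Transient R V L Op} (h : LoadConsistent C k v dep a)
    (hC : C.Replaced i limit t t' C') (hk : k ≤ limit)
    (haddr : i < k → ∀ src b, t' = .store src (.inr b) → b.val = a →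
      (i : WithBot ℕ) ≤ dep ∨ ∃ src₀, t = .store src₀ (.inr b))
    (hval : ∀ dst, t = .store (.val v) dst → dep = (i : WithBot ℕ) →
      (∀ b, dst = .inr b → b.val = a) →
      ∃ dst', t' = .store (.val v) dst' ∧ ∀ b, dst' = .inr b → b.val = a) :
    LoadConsistent C' k v dep a := by
  refine h.transfer hC.mem (fun j hj hn => ?_) (fun j hj hs => ?_) fun j hj hd dst hs hdst => ?_
  all_goals by_cases hji : j = i
  · cases hn.symm.trans (hji ▸ hC.old)
  · rwa [hC.get_of_ne hji (by omega)]
  · subst hji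
    obtain ⟨src, b, hb, hba⟩ := hs
    refine (haddr hj src b (Option.some.inj (hC.get_self.symm.trans hb)) hba).imp_right ?_
    rintro ⟨src₀, rfl⟩
    exact ⟨src₀, b, hC.old, hba⟩
  · exact .inr (by simpa only [Config.StoreAt, hC.get_of_ne hji (hj.trans_le hk)] using hs)
  · subst hji
    obtain ⟨dst', rfl, hdst'⟩ := hval dst (Option.some.inj (hC.old.symm.trans hs)) hd hdst
    exact ⟨dst', hC.get_self, hdst'⟩
  · exact ⟨dst, (hC.get_of_ne hji (hj.trans_le hk)).trans hs, hdst⟩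

theorem replaced_storeAddr {src : Operand R V L} {args : List (Operand R V L)} {b : LVal V L}
    {r : R} {pt : V} (h : LoadConsistent C k v dep a)
    (hC : C.Replaced i limit (.store src (.inl args)) (.store src (.inr b)) C') (hk : k ≤ limit)
    (hload : C.buf.get k = some (.loaded r v dep a pt)) (hhaz : ¬ C.Hazard i b.val k) :
    LoadConsistent C' k v dep a := by
  have unaffected (hik : i < k) : (a = b.val → (i : WithBot ℕ) ≤ dep) ∧
      (dep = (i : WithBot ℕ) → a = b.val) := by
    constructor
    · exact fun hab => not_lt.1 fun hdep => hhaz ⟨hik, r, v, dep, a, pt, hload, .inl ⟨hab, hdep⟩⟩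
    · exact fun hdep => by_contra fun hab =>
        hhaz ⟨hik, r, v, dep, a, pt, hload, .inr ⟨hdep, hab⟩⟩
  refine h.replaced hC hk (fun hik src' b' hb' hba => .inl ?_) fun dst hdst hdep _ => ?_
  · cases hb'
    exact (unaffected hik).1 hba.symm
  · cases hdst
    refine ⟨_, rfl, fun b' hb' => ?_⟩
    cases hb'
    exact ((unaffected (WithBot.coe_lt_coe.1 (hdep.symm.trans_lt h.dep_lt))).2 hdep).symm

theorem of_store {i j : ℕ} {dst : List (Operand R V L) ⊕ LVal V L} (hji : j < i)
    (hj : C.buf.get j = some (.store (.val v) dst)) (hdst : ∀ b, dst = .inr b → b.val = a)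
    (hk : ∀ k, j < k → k < i → ¬ C.StoreAt k a) : LoadConsistent C i v (j : WithBot ℕ) a where
  dep_lt := WithBot.coe_lt_coe.2 hji
  le_dep k hki hs := WithBot.coe_le_coe.2 (not_lt.1 fun hjk => hk k hjk hki hs)
  source := .inl ⟨j, dst, rfl, hj, hdst⟩

theorem of_mem (hk : ∀ j < k, ¬ C.StoreAt j a) (hv : C.mem a = some v) :
    LoadConsistent C k v ⊥ a where
  dep_lt := WithBot.bot_lt_coe k
  le_dep j hj hs := absurd hs (hk j hj)
  source := .inr ⟨fun j hj => absurd hj (WithBot.bot_lt_coe j).not_ge, hv⟩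

theorem mem_eq (h : LoadConsistent C k v dep a)
    (hs : ∀ j < k, ∀ src dst, C.buf.get j ≠ some (.store src dst)) : C.mem a = some v := by
  rcases h.source with ⟨j, dst, rfl, hj, -⟩ | ⟨-, h⟩
  · exact absurd hj (hs j (WithBot.coe_lt_coe.1 h.dep_lt) _ _)
  · exact h

theorem commits {M : Machine R V Op} (h : LoadConsistent C k v dep a) (hC : C.Commits M m C')
    (hmk : m ≤ k) : LoadConsistent C' k v dep a where
  dep_lt := h.dep_lt
  le_dep j hj := by
    rintro ⟨src, b, hs, hb⟩
    rw [hC.get] at hs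
    split_ifs at hs
    exact h.le_dep j hj ⟨src, b, hs, hb⟩
  source := by
    rcases h.source with ⟨j, dst, rfl, hj, hdst⟩ | ⟨hbuf, hv⟩
    · by_cases hjm : m ≤ j
      · exact .inl ⟨j, dst, rfl, by rw [hC.get, if_pos hjm, hj], hdst⟩
      · obtain ⟨w, b, hw, rfl, hb⟩ := hC.store j (by omega) _ _ hj
        cases hw
        refine .inr ⟨fun j' hj' => ?_, hdst b rfl ▸ hb⟩
        rw [hC.get, if_neg fun hm => hjm (hm.trans (WithBot.coe_le_coe.1 hj'))]
    · refine .inr ⟨fun j hj => by rw [hC.get, hbuf j hj, ite_self], ?_⟩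
      by_contra hne
      obtain ⟨j, hj, hs⟩ := hC.mem a fun heq => hne (heq.trans hv)
      obtain ⟨src, b, hs', -⟩ := id hs
      cases hs'.symm.trans (hbuf j (h.le_dep j (by omega) hs))

end LoadConsistent

/-- The operands of an unresolved transient instruction. -/
def Transient.operands : Transient R V L Op → List (Operand R V L)
  | .op _ _ args => args
  | .br _ args _ _ _ => args
  | .load _ args _ => args
  | .store src (.inl args) => src :: args
  | .jmpi args _ => args
  | _ => []

/-- The operand `x'` is `x` itself or the value of `x` under the register assignment `f`. -/
def Operand.IsStage (f : R → Option (LVal V L)) (x x' : Operand R V L) : Prop :=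
  x' = x ∨ ∃ v, evalOperand f x = some v ∧ x' = .val v

theorem Operand.IsStage.mono {f g : R → Option (LVal V L)} {x x' : Operand R V L}
    (h : x.IsStage f x') (hfg : ∀ r, x = .reg r → ∀ v, f r = some v → g r = some v) :
    x.IsStage g x' :=
  h.imp_right fun ⟨v, hv, hx'⟩ => ⟨v, evalOperand_mono hfg hv, hx'⟩

theorem Operand.IsStage.eval_eq {f : R → Option (LVal V L)} {x x' : Operand R V L} {v : LVal V L}
    (h : x.IsStage f x') (hv : evalOperand f x' = some v) : evalOperand f x = some v := by
  rcases h with rfl | ⟨w, hw, rfl⟩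
  · exact hv
  · exact hw.trans hv

/-- `Refines M C k t₀ t T`: at index `k` of `C`, the entry `t` is a consistent stage of the
execution of the fetched entry `t₀`, and `T` are the labels exposed by resolving it. -/
inductive Refines [Lattice L] [OrderBot L] (M : Machine R V Op) (C : Config R V L Op) (k : ℕ) :
    Transient R V L Op → Transient R V L Op → Set L → Prop
  | op (r : R) (o : Op) (args : List (Operand R V L)) :
      Refines M C k (.op r o args) (.op r o args) ∅
  | value {r : R} {o : Op} {args : List (Operand R V L)} {v : LVal V L}
      (hv : EvalTo (M.evalOp o) (C.resolveReg k) args v) :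
      Refines M C k (.op r o args) (.value r v) ∅
  | br (o : Op) (args : List (Operand R V L)) (g nT nF : V) :
      Refines M C k (.br o args g nT nF) (.br o args g nT nF) ∅
  | brJump {o : Op} {args : List (Operand R V L)} {nT nF : V} {n : LVal V L}
      (hn : EvalTo (M.branchTarget o nT nF) (C.resolveReg k) args n) :
      Refines M C k (.br o args n.val nT nF) (.jump n.val) {n.lab}
  | jmpi (args : List (Operand R V L)) (g : V) :
      Refines M C k (.jmpi args g) (.jmpi args g) ∅
  | jmpiJump {args : List (Operand R V L)} {n : LVal V L}
      (hn : EvalTo M.addr (C.resolveReg k) args n) :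
      Refines M C k (.jmpi args n.val) (.jump n.val) {n.lab}
  | load (r : R) (args : List (Operand R V L)) (pt : V) :
      Refines M C k (.load r args pt) (.load r args pt) ∅
  | loadGuess {r : R} {args : List (Operand R V L)} {v : LVal V L} {j : ℕ} {pt : V} (hj : j < k)
      (hs : ∀ t, C.buf.get j = some t → ∃ dst, t = .store (.val v) dst) :
      Refines M C k (.load r args pt) (.loadGuess r args v j pt) ∅
  | loaded {r : R} {args : List (Operand R V L)} {v a : LVal V L} {dep : WithBot ℕ} {pt : V}
      (ha : EvalTo M.addr (C.resolveReg k) args a) (hl : LoadConsistent C k v dep a.val) :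
      Refines M C k (.load r args pt) (.loaded r v dep a.val pt) {a.lab}
  | store {src src' : Operand R V L} {args : List (Operand R V L)}
      (hs : src.IsStage (C.resolveReg k) src') :
      Refines M C k (.store src (.inl args)) (.store src' (.inl args)) ∅
  | storeAddr {src src' : Operand R V L} {args : List (Operand R V L)} {a : LVal V L}
      (hs : src.IsStage (C.resolveReg k) src') (ha : EvalTo M.addr (C.resolveReg k) args a) :
      Refines M C k (.store src (.inl args)) (.store src' (.inr a)) {a.lab}
  | call : Refines M C k .call .call ∅
  | ret : Refines M C k .ret .ret ∅
  | fence : Refines M C k .fence .fence ∅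

namespace Refines

variable [Lattice L] [OrderBot L] {M : Machine R V Op} {C C' : Config R V L Op} {k : ℕ}
  {t₀ t : Transient R V L Op} {T : Set L}

theorem target_eq (h : Refines M C k t₀ t T) : t.target = t₀.target := by
  cases h <;> rfl

theorem eq_ret_iff (h : Refines M C k t₀ t T) : t = .ret ↔ t₀ = .ret := by
  cases h <;> simp

theorem mono (h : Refines M C k t₀ t T)
    (hreg : ∀ r, .reg r ∈ t₀.operands → ∀ v, C.resolveReg k r = some v →
      C'.resolveReg k r = some v)
    (hload : ∀ r v dep a pt, t = .loaded r v dep a pt → LoadConsistent C k v dep a →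
      LoadConsistent C' k v dep a)
    (hguess : ∀ j < k, ∀ v : LVal V L,
      (∀ t, C.buf.get j = some t → ∃ dst, t = .store (.val v) dst) →
      ∀ t, C'.buf.get j = some t → ∃ dst, t = .store (.val v) dst) :
    Refines M C' k t₀ t T := by
  cases h with
  | op => exact .op _ _ _
  | value hv => exact .value (hv.mono hreg)
  | br => exact .br _ _ _ _ _
  | brJump hn => exact .brJump (hn.mono hreg)
  | jmpi => exact .jmpi _ _
  | jmpiJump hn => exact .jmpiJump (hn.mono hreg)
  | load => exact .load _ _ _
  | loadGuess hj hs => exact .loadGuess hj (hguess _ hj _ hs)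
  | loaded ha hl => exact .loaded (ha.mono hreg) (hload _ _ _ _ _ rfl hl)
  | store hs =>
    exact .store (hs.mono fun r hr => hreg r (hr ▸ List.mem_cons_self))
  | storeAddr hs ha =>
    exact .storeAddr (hs.mono fun r hr => hreg r (hr ▸ List.mem_cons_self))
      (ha.mono fun r hr => hreg r (List.mem_cons_of_mem _ hr))
  | call => exact .call
  | ret => exact .ret
  | fence => exact .fence

theorem congr (h : Refines M C k t₀ t T) (hreg : C'.reg = C.reg) (hmem : C'.mem = C.mem)
    (hbuf : ∀ j < k, C'.buf.get j = C.buf.get j) : Refines M C' k t₀ t T := by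
  refine h.mono (fun r _ v hv => ?_) (fun r v dep a pt _ hl => hl.congr hmem hbuf)
    fun j hj v hs => ?_
  · rwa [Config.resolveReg_congr hreg hbuf]
  · rwa [hbuf j hj]

end Refines

/-! ### Fetched instructions -/

/-- The entry `t` of a branch or an indirect jump with its predicted target replaced by `g`; `none`
for all other entries. -/
def Transient.retarget (g : V) : Transient R V L Op → Option (Transient R V L Op)
  | .br o args _ nT nF => some (.br o args g nT nF)
  | .jmpi args _ => some (.jmpi args g)
  | _ => none

/-- `Fetched M P n ts m`: the instruction at program point `n` is fetched as the buffer entries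
`ts`, with predicted successor `m`. -/
inductive Fetched [Lattice L] [OrderBot L] (M : Machine R V Op) (P : Program R V L Op) (n : V) :
    List (Transient R V L Op) → V → Prop
  | op {o : Op} {r : R} {args : List (Operand R V L)} {next : V}
      (hP : P n = some (.op o r args next)) : Fetched M P n [.op r o args] next
  | br {o : Op} {args : List (Operand R V L)} {nT nF : V} (g : V)
      (hP : P n = some (.br o args nT nF)) : Fetched M P n [.br o args g nT nF] g
  | load {r : R} {args : List (Operand R V L)} {next : V}
      (hP : P n = some (.load r args next)) : Fetched M P n [.load r args n] next
  | store {src : Operand R V L} {args : List (Operand R V L)} {next : V}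
      (hP : P n = some (.store src args next)) : Fetched M P n [.store src (.inl args)] next
  | jmpi {args : List (Operand R V L)} (g : V)
      (hP : P n = some (.jmpi args)) : Fetched M P n [.jmpi args g] g
  | call {nf nret : V} (hP : P n = some (.call nf nret)) :
      Fetched M P n [.call, .op M.rsp M.succ [.reg M.rsp],
        .store (.val ⟨nret, ⊥⟩) (.inl [.reg M.rsp])] nf
  | ret (g : V) (hP : P n = some .ret) :
      Fetched M P n [.ret, .load M.rret [.reg M.rsp] n, .op M.rsp M.pred [.reg M.rsp],
        .jmpi [.reg M.rret] g] g
  | fence {next : V} (hP : P n = some (.fence next)) : Fetched M P n [.fence] next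

namespace Fetched

variable [Lattice L] [OrderBot L] {M : Machine R V Op} {P : Program R V L Op} {n m : V}
  {ts : List (Transient R V L Op)} {k : ℕ}

theorem length_pos (h : Fetched M P n ts m) : 0 < ts.length := by
  cases h <;> simp

theorem eq_call (h : Fetched M P n ts m) (h₀ : ts[0]? = some .call) :
    ∃ nret, P n = some (.call m nret) ∧ ts = [.call, .op M.rsp M.succ [.reg M.rsp],
      .store (.val ⟨nret, ⊥⟩) (.inl [.reg M.rsp])] := by
  cases h with
  | call hP => exact ⟨_, hP, rfl⟩
  | _ => cases h₀

theorem eq_ret (h : Fetched M P n ts m) (h₀ : ts[0]? = some .ret) :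
    P n = some .ret ∧ ts = [.ret, .load M.rret [.reg M.rsp] n, .op M.rsp M.pred [.reg M.rsp],
      .jmpi [.reg M.rret] m] := by
  cases h with
  | ret _ hP => exact ⟨hP, rfl⟩
  | _ => cases h₀

theorem getLast?_ne_ret (h : Fetched M P n ts m) : ts.getLast? ≠ some .ret := by
  cases h <;> simp

theorem not_load_and_store (h : Fetched M P n ts m) {r : R} {args args' : List (Operand R V L)}
    {pt : V} {src : Operand R V L} (hload : .load r args pt ∈ ts) :
    .store src (.inl args') ∉ ts := by
  cases h <;> simp_all

theorem eq_of_load (h : Fetched M P n ts m) {r : R} {args : List (Operand R V L)} {pt : V}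
    (hk : ts[k]? = some (.load r args pt)) :
    pt = n ∧ (k = 0 ∨ k = 1 ∧ ts[0]? = some .ret) := by
  cases h with
  | ret =>
    rcases k with _ | _ | _ | _ | k <;> simp_all
  | call =>
    rcases k with _ | _ | _ | k <;> simp_all
  | _ => rcases k with _ | k <;> simp_all

theorem exists_load_rret (hP : P.NotRead M.rret) (h : Fetched M P n ts m)
    {t : Transient R V L Op} (hk : ts[k]? = some t) (ht : .reg M.rret ∈ t.operands) :
    ∃ j < k, ts[j]? = some (.load M.rret [.reg M.rsp] n) := by
  have hne := M.rret_ne_rsp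
  cases h with
  | ret g hP' =>
    rcases k with _ | _ | _ | _ | k
    on_goal 4 => exact ⟨1, by omega, rfl⟩
    all_goals cases hk
    all_goals simp [Transient.operands, hne] at ht
  | call hP' =>
    rcases k with _ | _ | _ | k <;> cases hk
    all_goals simp [Transient.operands, hne] at ht
  | _ =>
    rename_i hP'
    rcases k with _ | k <;> cases hk
    exact absurd ht (hP _ _ hP')

theorem retarget (h : Fetched M P n ts m) {t t' : Transient R V L Op} {g : V}
    (hk : ts[k]? = some t) (ht' : t.retarget g = some t') :
    k + 1 = ts.length ∧ Fetched M P n (ts.set k t') g := by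
  cases h with
  | br _ hP =>
    rcases k with _ | k <;> cases hk
    cases ht'
    exact ⟨rfl, .br g hP⟩
  | jmpi _ hP =>
    rcases k with _ | k <;> cases hk
    cases ht'
    exact ⟨rfl, .jmpi g hP⟩
  | ret _ hP =>
    rcases k with _ | _ | _ | _ | k <;> cases hk
    all_goals cases ht'
    exact ⟨rfl, .ret g hP⟩
  | call hP =>
    rcases k with _ | _ | _ | k <;> cases hk
    all_goals cases ht'
  | _ =>
    rcases k with _ | k <;> cases hk
    cases ht'

end Fetched

/-- The list `ts` consists of the values of `orig` at the indices `b, b + 1, …`. -/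
def ListsFrom (orig : ℕ → Transient R V L Op) (b : ℕ) (ts : List (Transient R V L Op)) : Prop :=
  ∀ k < ts.length, ts[k]? = some (orig (b + k))

namespace ListsFrom

variable {orig orig' : ℕ → Transient R V L Op} {b k : ℕ} {ts : List (Transient R V L Op)}

theorem getElem?_sub (h : ListsFrom orig b ts) (hb : b ≤ k) (hk : k < b + ts.length) :
    ts[k - b]? = some (orig k) := by
  rw [h (k - b) (by omega), Nat.add_sub_cancel' hb]

theorem mem (h : ListsFrom orig b ts) (hb : b ≤ k) (hk : k < b + ts.length) : orig k ∈ ts :=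
  List.mem_of_getElem? (h.getElem?_sub hb hk)

theorem congr (h : ListsFrom orig b ts)
    (ho : ∀ k, b ≤ k → k < b + ts.length → orig' k = orig k) : ListsFrom orig' b ts :=
  fun k hk => by rw [h k hk, ho _ (by omega) (by omega)]

theorem update (h : ListsFrom orig b ts) (hb : b ≤ k) (t : Transient R V L Op) :
    ListsFrom (Function.update orig k t) b (ts.set (k - b) t) := fun j hj => by
  rw [List.length_set] at hj
  by_cases hjk : b + j = k
  · subst hjk
    simp [hj]
  · rw [List.getElem?_set_ne (by omega), h j hj, Function.update_of_ne hjk]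

end ListsFrom

/-- `Chain M P orig b n e m c`: the entries `orig` at `b, …, e - 1` are those fetched for `c`
consecutive instructions, the first one at program point `n`, continuing at `m`. -/
inductive Chain [Lattice L] [OrderBot L] (M : Machine R V Op) (P : Program R V L Op)
    (orig : ℕ → Transient R V L Op) : ℕ → V → ℕ → V → ℕ → Prop
  | nil (b : ℕ) (n : V) : Chain M P orig b n b n 0
  | cons {b e c : ℕ} {n q m : V} {ts : List (Transient R V L Op)} (hts : ListsFrom orig b ts)
      (h : Fetched M P n ts q) (h' : Chain M P orig (b + ts.length) q e m c) :
      Chain M P orig b n e m (c + 1)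

namespace Chain

variable [Lattice L] [OrderBot L] {M : Machine R V Op} {P : Program R V L Op}
  {orig orig' : ℕ → Transient R V L Op} {b e c k : ℕ} {n m : V}

theorem le (h : Chain M P orig b n e m c) : b ≤ e := by
  induction h with
  | nil => exact le_rfl
  | cons _ _ _ ih => omega

theorem congr (h : Chain M P orig b n e m c) (ho : ∀ k, b ≤ k → k < e → orig' k = orig k) :
    Chain M P orig' b n e m c := by
  induction h with
  | nil => exact .nil _ _
  | cons hts hf hc ih =>
    have := hc.le
    exact .cons (hts.congr fun k hb hk => ho k hb (by omega)) hf
      (ih fun k hb hk => ho k (by omega) hk)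

theorem snoc {i : ℕ} {p : V} {ts : List (Transient R V L Op)} (h : Chain M P orig b n i p c)
    (hts : ListsFrom orig i ts) (hf : Fetched M P p ts m) :
    Chain M P orig b n (i + ts.length) m (c + 1) := by
  induction h with
  | nil => exact .cons hts hf (.nil _ _)
  | cons hts' hf' _ ih => exact .cons hts' hf' (ih hts hf)

theorem split (h : Chain M P orig b n e m c) (hb : b ≤ k) (he : k < e) :
    ∃ s ts c₁ c₂ p q, Chain M P orig b n s p c₁ ∧ ListsFrom orig s ts ∧ Fetched M P p ts q ∧
      Chain M P orig (s + ts.length) q e m c₂ ∧ s ≤ k ∧ k < s + ts.length ∧ c = c₁ + 1 + c₂ := by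
  induction h with
  | nil => omega
  | @cons b e c n q m ts hts hf hc ih =>
    by_cases hk : k < b + ts.length
    · exact ⟨b, ts, 0, c, n, q, .nil _ _, hts, hf, hc, hb, hk, by omega⟩
    · obtain ⟨s, us, c₁, c₂, p, q', hc₁, hus, hf', hc₂, hsk, hks, rfl⟩ := ih (by omega) he
      exact ⟨s, us, c₁ + 1, c₂, p, q', .cons hts hf hc₁, hus, hf', hc₂, hsk, hks, by omega⟩

theorem eq_of_count_eq_zero (h : Chain M P orig b n e m 0) : b = e ∧ n = m := by
  cases h
  exact ⟨rfl, rfl⟩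

theorem count_eq_zero (h : Chain M P orig b n b m c) : c = 0 ∧ n = m := by
  cases h with
  | nil => exact ⟨rfl, rfl⟩
  | cons _ hf hc =>
    have := hf.length_pos
    have := hc.le
    omega

theorem last_ne_ret (h : Chain M P orig b n e m c) (hbe : b < e) : orig (e - 1) ≠ .ret := by
  induction h with
  | nil => omega
  | @cons b e c n q m ts hts hf hc ih =>
    rcases hc.le.lt_or_eq with hlt | rfl
    · exact ih hlt
    · have hlast := hts.getElem?_sub (k := b + ts.length - 1) (by omega) (by omega)
      rw [show b + ts.length - 1 - b = ts.length - 1 by omega, ← List.getLast?_eq_getElem?] at hlast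
      exact fun hret => hf.getLast?_ne_ret (hlast.trans (congrArg some hret))

theorem exists_load_rret (hP : P.NotRead M.rret) (h : Chain M P orig b n e m c) (hb : b ≤ k)
    (he : k < e) (hk : .reg M.rret ∈ (orig k).operands) :
    ∃ j pt, b ≤ j ∧ j < k ∧ orig j = .load M.rret [.reg M.rsp] pt := by
  obtain ⟨s, ts, c₁, c₂, p, q, hc₁, hts, hf, -, hsk, hks, -⟩ := h.split hb he
  obtain ⟨j, hj, hload⟩ := hf.exists_load_rret hP (hts.getElem?_sub hsk hks) hk
  have := hc₁.le
  exact ⟨s + j, p, by omega, by omega,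
    Option.some.inj ((hts j (by omega)).symm.trans hload)⟩

theorem split_load (h : Chain M P orig b n e m c) (hb : b ≤ k) (he : k < e) {r : R}
    {args : List (Operand R V L)} {pt : V} (hk : orig k = .load r args pt) :
    ∃ s c₁, Chain M P orig b n s pt c₁ ∧ c₁ < c ∧ (s = k ∨ s + 1 = k ∧ orig s = .ret) := by
  obtain ⟨s, ts, c₁, c₂, p, q, hc₁, hts, hf, -, hsk, hks, rfl⟩ := h.split hb he
  obtain ⟨rfl, hpos⟩ := hf.eq_of_load (hk ▸ hts.getElem?_sub hsk hks)
  refine ⟨s, c₁, hc₁, by omega, hpos.imp (fun hzero => by omega) fun ⟨_, hret⟩ => ?_⟩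
  exact ⟨by omega, Option.some.inj ((hts 0 (by omega)).symm.trans hret)⟩

theorem not_load_and_store_of_count_le_one {j : ℕ} (h : Chain M P orig b n e m c) (hc : c ≤ 1)
    (hbk : b ≤ k) (hke : k < e) (hbj : b ≤ j) (hje : j < e) {r : R}
    {args args' : List (Operand R V L)} {pt : V} {src : Operand R V L}
    (hk : orig k = .load r args pt) : orig j ≠ .store src (.inl args') := by
  obtain ⟨s, ts, c₁, c₂, p, q, hc₁, hts, hf, hc₂, hsk, hks, rfl⟩ := h.split hbk hke
  obtain ⟨rfl, rfl⟩ : c₁ = 0 ∧ c₂ = 0 := by omega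
  obtain ⟨rfl, -⟩ := hc₁.eq_of_count_eq_zero
  obtain ⟨rfl, -⟩ := hc₂.eq_of_count_eq_zero
  exact fun hj => hf.not_load_and_store (hk ▸ hts.mem hbk hke) (hj ▸ hts.mem hbj hje)

theorem redirect {i : ℕ} {t : Transient R V L Op} {g : V} (h : Chain M P orig b n e m c)
    (hb : b ≤ i) (he : i < e) (ht : (orig i).retarget g = some t) :
    ∃ c' ≤ c, Chain M P (Function.update orig i t) b n (i + 1) g c' ∧ (c ≤ 1 → i + 1 = e) := by
  obtain ⟨s, ts, c₁, c₂, p, q, hc₁, hts, hf, hc₂, hsi, his, rfl⟩ := h.split hb he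
  obtain ⟨hlast, hf'⟩ := hf.retarget (hts.getElem?_sub hsi his) ht
  refine ⟨c₁ + 1, by omega, ?_, fun hc => ?_⟩
  · have hc₁' : Chain M P (Function.update orig i t) b n s p c₁ :=
      hc₁.congr fun k _ hk => Function.update_of_ne (by omega) _ _
    have := hc₁'.snoc (hts.update hsi t) hf'
    rwa [List.length_set, ← hlast, show s + (i - s + 1) = i + 1 by omega] at this
  · obtain rfl : c₂ = 0 := by omega
    obtain ⟨rfl, -⟩ := hc₂.eq_of_count_eq_zero
    omega

end Chain

/-! ### The invariant -/

/-- Ghost state of the invariant `Consistent`: the buffer occupies the indices `first, …, limit - 1`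
and holds `count` instructions, the oldest one at program point `pc`. The entry at index `k` was
fetched as `orig k`, up to the predicted targets, which `orig` records corrected, and has exposed
the labels `lab k`. -/
structure Window (R V L Op : Type*) where
  orig : ℕ → Transient R V L Op
  lab : ℕ → Set L
  first : ℕ
  limit : ℕ
  count : ℕ
  pc : V

namespace Window

/-- The labels exposed by the instructions in flight. -/
def labels (W : Window R V L Op) : Set L := {l | ∃ k, W.first ≤ k ∧ k < W.limit ∧ l ∈ W.lab k}

/-- The ghost state after an execution step at index `i` that keeps the indices below `limit`. -/
def replace (W : Window R V L Op) (i : ℕ) (t : Transient R V L Op) (T : Set L)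
    (limit count : ℕ) : Window R V L Op :=
  { W with
    orig := Function.update W.orig i t
    lab := Function.update W.lab i T
    limit := limit
    count := count }

variable {W : Window R V L Op} {i limit count : ℕ} {t : Transient R V L Op} {T S : Set L}

theorem labels_eq_empty (h : W.limit ≤ W.first) : W.labels = ∅ :=
  Set.eq_empty_of_forall_notMem fun _ ⟨_, hfirst, hlimit, _⟩ => by omega

theorem labels_replace_subset (hT : T ⊆ W.lab i ∪ S) (hfirst : W.first ≤ i) (hi : i < W.limit)
    (hlimit : limit ≤ W.limit) : (W.replace i t T limit count).labels ⊆ W.labels ∪ S := by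
  rintro l ⟨k, hk, hks, hl⟩
  by_cases hki : k = i
  · subst hki
    simp only [replace, Function.update_self] at hl
    exact (hT hl).imp_left fun hl => ⟨k, hfirst, hi, hl⟩
  · simp only [replace, Function.update_of_ne hki] at hl
    exact .inl ⟨k, hk, hks.trans_le hlimit, hl⟩

theorem subset_labels_replace (hT : W.lab i ∪ S ⊆ T) (hfirst : W.first ≤ i) (hi : i < W.limit) :
    W.labels ∪ S ⊆ (W.replace i t T W.limit count).labels := by
  rintro l (⟨k, hk, hks, hl⟩ | hl)
  · refine ⟨k, hk, hks, ?_⟩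
    simp only [replace, Function.update_apply]
    split_ifs with hki
    · subst hki
      exact hT (.inl hl)
    · exact hl
  · refine ⟨i, hfirst, hi, ?_⟩
    simp only [replace, Function.update_self]
    exact hT (.inr hl)

end Window

theorem Config.loadStart_le (C : Config R V L Op) {k : ℕ} : C.loadStart k ≤ k := by
  rw [Config.loadStart]
  split_ifs <;> omega

theorem Config.lt_loadStart (C : Config R V L Op) {i k : ℕ} (hik : i < k)
    (hi : C.buf.get i ≠ some .ret) : i < C.loadStart k := by
  rw [Config.loadStart]
  split_ifs with h
  · rcases (Nat.le_sub_one_of_lt hik).lt_or_eq with hlt | rfl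
    · exact hlt
    · exact absurd h hi
  · exact hik

/-- No load has been forwarded a guessed value. -/
def Config.NoGuess (C : Config R V L Op) : Prop :=
  ∀ k r args v j pt, C.buf.get k ≠ some (.loadGuess r args v j pt)

/-- The buffer of `C` is described by `W`, with all entries in consistent stages of execution. -/
structure Consistent [Lattice L] [OrderBot L] (M : Machine R V Op) (P : Program R V L Op)
    (C : Config R V L Op) (W : Window R V L Op) : Prop where
  chain : Chain M P W.orig W.first W.pc W.limit C.pc W.count
  entry : ∀ k, W.first ≤ k → k < W.limit →
    ∃ t, C.buf.get k = some t ∧ Refines M C k (W.orig k) t (W.lab k)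
  outside : ∀ k, C.buf.get k ≠ none → W.first ≤ k ∧ k < W.limit

namespace Consistent

variable [Lattice L] [OrderBot L] {M : Machine R V Op} {P : Program R V L Op}
  {C C' : Config R V L Op} {W : Window R V L Op} {i limit : ℕ} {t t' : Transient R V L Op}

theorem exists_refines (hW : Consistent M P C W) (hi : C.buf.get i = some t) :
    ∃ t₀ T, W.orig i = t₀ ∧ W.lab i = T ∧ W.first ≤ i ∧ i < W.limit ∧ Refines M C i t₀ t T := by
  obtain ⟨hfirst, hlimit⟩ := hW.outside i (hi ▸ Option.some_ne_none t)
  obtain ⟨u, hu, href⟩ := hW.entry i hfirst hlimit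
  cases hi.symm.trans hu
  exact ⟨_, _, rfl, rfl, hfirst, hlimit, href⟩

theorem get_eq_none_of_lt (hW : Consistent M P C W) (hi : i < W.first) : C.buf.get i = none :=
  not_not.1 fun hne => hi.not_ge (hW.outside i hne).1

theorem get_eq_none_of_ge (hW : Consistent M P C W) (hi : W.limit ≤ i) : C.buf.get i = none :=
  not_not.1 fun hne => hi.not_gt (hW.outside i hne).2

theorem get_ne_none_iff (hW : Consistent M P C W) :
    C.buf.get i ≠ none ↔ W.first ≤ i ∧ i < W.limit :=
  ⟨hW.outside i, fun ⟨hfirst, hlimit⟩ => by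
    obtain ⟨u, hu, -⟩ := hW.entry i hfirst hlimit
    exact hu ▸ Option.some_ne_none u⟩

theorem idle_iff (hW : Consistent M P C W) : C.Idle ↔ W.count = 0 := by
  have hchain := hW.chain
  refine ⟨fun hC => ?_, fun hc => FMap.ext_get fun k => not_not.1 fun hk => ?_⟩
  · rcases hchain.le.lt_or_eq with hlt | heq
    · exact absurd (congrArg (FMap.get · W.first) hC) (hW.get_ne_none_iff.2 ⟨le_rfl, hlt⟩)
    · exact (heq ▸ hchain).count_eq_zero.1
  · have := hW.outside k hk
    have := (hc ▸ hchain).eq_of_count_eq_zero.1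
    omega

theorem resolveReg_replaced (hW : Consistent M P C W) (hC : C.Replaced i limit t t' C')
    (hadv : t.Advances t') (hlimit : limit ≤ W.limit) {k : ℕ} (hfirst : W.first ≤ k)
    (hk : k ≤ limit) {r : R} {v : LVal V L} (hv : C.resolveReg k r = some v) :
    C'.resolveReg k r = some v := by
  have hi : W.first ≤ i := (hW.outside i (hC.old ▸ Option.some_ne_none t)).1
  refine Config.resolveReg_mono hfirst (fun _ v hv => ?_) (fun j hj hjk => ?_) hv
  · rwa [Config.resolveReg_congr hC.reg fun j hj => hC.get_of_ne (by omega) (by omega)]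
  · obtain ⟨s, hs, -⟩ := hW.entry j hj (by omega)
    obtain ⟨s', hs', hadv'⟩ := hC.exists_advances hadv (by omega) hs
    exact ⟨s, s', hs, hs', hadv'⟩

theorem replaced (hW : Consistent M P C W) (hC : C.Replaced i limit t t' C')
    (hadv : t.Advances t') (hlimit : limit ≤ W.limit) {t₀ : Transient R V L Op} {T : Set L} {c : ℕ}
    (hchain : Chain M P (Function.update W.orig i t₀) W.first W.pc limit C'.pc c)
    (href : Refines M C i t₀ t' T)
    (hload : ∀ k r v dep a pt, i < k → k < limit → C.buf.get k = some (.loaded r v dep a pt) →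
      LoadConsistent C k v dep a → LoadConsistent C' k v dep a) :
    Consistent M P C' (W.replace i t₀ T limit c) where
  chain := hchain
  outside k hk := by
    rw [hC.get] at hk
    split_ifs at hk with hki hks
    · subst hki
      exact ⟨(hW.outside k (hC.old ▸ Option.some_ne_none t)).1, hC.lt⟩
    · exact ⟨(hW.outside k hk).1, hks⟩
    · exact absurd rfl hk
  entry k hfirst hks := by
    change W.first ≤ k at hfirst
    change k < limit at hks
    have same (hk : k ≤ i) : ∀ j < k, C'.buf.get j = C.buf.get j := fun j hj =>
      hC.get_of_ne (by omega) (by omega)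
    by_cases hki : k = i
    · subst hki
      simp only [Window.replace, Function.update_self]
      exact ⟨t', hC.get_self, href.congr hC.reg hC.mem (same le_rfl)⟩
    obtain ⟨u, hu, hru⟩ := hW.entry k hfirst (hks.trans_le hlimit)
    simp only [Window.replace, Function.update_of_ne hki]
    refine ⟨u, (hC.get_of_ne hki hks).trans hu, ?_⟩
    rcases Nat.lt_or_gt_of_ne hki with hlt | hgt
    · exact hru.congr hC.reg hC.mem (same hlt.le)
    refine hru.mono (fun r _ v hv => ?_) (fun r v dep a pt hut hl => ?_)
      fun j hj v hs s hsj => ?_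
    · exact hW.resolveReg_replaced hC hadv hlimit hfirst hks.le hv
    · exact hload k r v dep a pt hgt hks (hut ▸ hu) hl
    · by_cases hji : j = i
      · subst hji
        obtain ⟨dst, rfl⟩ := hs t hC.old
        cases hsj.symm.trans hC.get_self
        exact hadv.storeValue v dst rfl
      · exact hs s ((hC.get_of_ne hji (hj.trans hks)).symm.trans hsj)

theorem rollback (hW : Consistent M P C W) {n : V} {c : ℕ}
    (hchain : Chain M P W.orig W.first W.pc limit n c) (hlimit : limit ≤ W.limit) :
    Consistent M P (C.rollback limit n) { W with limit := limit, count := c } where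
  chain := hchain
  outside k hk := by
    rw [Config.rollback, FMap.get_below] at hk
    split_ifs at hk with hks
    · exact ⟨(hW.outside k hk).1, hks⟩
    · exact absurd rfl hk
  entry k hfirst hks := by
    have hget : ∀ j < limit, (C.rollback limit n).buf.get j = C.buf.get j := fun j hj => if_pos hj
    obtain ⟨u, hu, hru⟩ := hW.entry k hfirst (hks.trans_le hlimit)
    exact ⟨u, (hget k hks).trans hu, hru.congr rfl rfl fun j hj => hget j (hj.trans hks)⟩

theorem chain_loadStart (hW : Consistent M P C W) {k : ℕ} (hfirst : W.first ≤ k)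
    (hlimit : k < W.limit) {r : R} {args : List (Operand R V L)} {pt : V}
    (hk : W.orig k = .load r args pt) :
    ∃ c < W.count, Chain M P W.orig W.first W.pc (C.loadStart k) pt c := by
  obtain ⟨s, c, hchain, hc, rfl | ⟨rfl, hret⟩⟩ := hW.chain.split_load hfirst hlimit hk
  all_goals refine ⟨c, hc, ?_⟩
  · suffices hne : C.buf.get (s - 1) ≠ some .ret by rwa [Config.loadStart, if_neg hne]
    intro hret
    obtain ⟨_, _, horig, -, hfirst', -, href⟩ := hW.exists_refines hret
    replace horig := horig.trans (href.eq_ret_iff.1 rfl)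
    by_cases hlt : W.first < s
    · exact hchain.last_ne_ret hlt horig
    · rw [show s - 1 = s by omega, hk] at horig
      cases horig
  · obtain ⟨t, ht, href⟩ := hW.entry s hchain.le (by omega)
    rw [href.eq_ret_iff.2 hret] at ht
    rwa [Config.loadStart, Nat.add_sub_cancel, if_pos ht]

end Consistent

/-! ### Simulation by the in-order machine: execution steps -/

section Simulation

variable [DecidableEq R] [DecidableEq V] [Lattice L] [OrderBot L] {M : Machine R V Op}
  {P : Program R V L Op} {C C' C'' : Config R V L Op} {W W' W'' : Window R V L Op}
  {A A' : Set L} {O O' : List (Obs V L)} {D D' : List (Directive V)} {d : Directive V}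

/-- The execution of the schedule `D` from `C` to `C'` with trace `O` corresponds to a run of the
in-order machine that executes the retired instructions and exposes the labels `A`. Retired
instructions and instructions in flight expose only labels that occur in `O` or have been exposed
before. -/
structure Simulates (M : Machine R V Op) (P : Program R V L Op) (C : Config R V L Op)
    (W : Window R V L Op) (D : List (Directive V)) (O : List (Obs V L)) (C' : Config R V L Op)
    (W' : Window R V L Op) (A : Set L) : Prop where
  consistent : Consistent M P C' W'
  archRun : ArchRun M P ⟨C.reg, C.mem, W.pc⟩ (numRetired D) A ⟨C'.reg, C'.mem, W'.pc⟩
  labels_subset : A ∪ W'.labels ⊆ W.labels ∪ obsLabels O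
  count_le : W'.count + numRetired D ≤ W.count + D.countP Directive.isFetch

theorem Simulates.trans (h : Simulates M P C W D O C' W' A)
    (h' : Simulates M P C' W' D' O' C'' W'' A') :
    Simulates M P C W (D ++ D') (O ++ O') C'' W'' (A ∪ A') where
  consistent := h'.consistent
  archRun := by
    rw [numRetired, List.countP_append]
    exact h.archRun.append h'.archRun
  labels_subset := calc
    A ∪ A' ∪ W''.labels ⊆ A ∪ (W'.labels ∪ obsLabels O') := by
      rw [Set.union_assoc]
      exact Set.union_subset_union_right _ h'.labels_subset
    _ ⊆ W.labels ∪ obsLabels O ∪ obsLabels O' := by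
      rw [← Set.union_assoc]
      exact Set.union_subset_union_left _ h.labels_subset
    _ = W.labels ∪ obsLabels (O ++ O') := by rw [obsLabels_append, Set.union_assoc]
  count_le := by
    have := h.count_le
    have := h'.count_le
    simp only [numRetired, List.countP_append] at *
    omega

/-- The step from `C` to `C'` is simulated by the in-order machine. If nothing is speculative and
at most one instruction is in flight, then this remains so and the step does not expose any other
labels. -/
def StepSimulated (M : Machine R V Op) (P : Program R V L Op) (W : Window R V L Op)
    (C : Config R V L Op) (d : Directive V) (O : List (Obs V L)) (C' : Config R V L Op) : Prop :=
  ∃ W' A, Simulates M P C W [d] O C' W' A ∧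
    (C.NoGuess → W.count ≤ 1 → (d.isFetch → W.count = 0) →
      C'.NoGuess ∧ W.labels ∪ obsLabels O ⊆ A ∪ W'.labels)

namespace Consistent

variable {i limit : ℕ} {t t' : Transient R V L Op}

theorem stepSimulated_of_replaced (hW : Consistent M P C W) (hC : C.Replaced i limit t t' C')
    (hadv : t.Advances t') (hlimit : limit ≤ W.limit) {t₀ : Transient R V L Op} {T : Set L} {c : ℕ}
    (hchain : Chain M P (Function.update W.orig i t₀) W.first W.pc limit C'.pc c)
    (href : Refines M C i t₀ t' T) (hT : T = W.lab i ∪ obsLabels O) (hc : c ≤ W.count)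
    (hd : d.isRetire = false)
    (hload : ∀ k r v dep a pt, i < k → k < limit → C.buf.get k = some (.loaded r v dep a pt) →
      LoadConsistent C k v dep a → LoadConsistent C' k v dep a)
    (hseq : C.NoGuess → W.count ≤ 1 →
      limit = W.limit ∧ ∀ r args v j pt, t' ≠ .loadGuess r args v j pt) :
    StepSimulated M P W C d O C' := by
  obtain ⟨hfirst, hi⟩ := hW.outside i (hC.old ▸ Option.some_ne_none t)
  have hret : numRetired [d] = 0 := by simp [numRetired, hd]
  refine ⟨W.replace i t₀ T limit c, ∅, ⟨hW.replaced hC hadv hlimit hchain href hload, ?_, ?_, ?_⟩,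
    fun hng hone _ => ?_⟩
  · rw [hret, hC.reg, hC.mem]
    exact .nil _
  · rw [Set.empty_union]
    exact Window.labels_replace_subset hT.subset hfirst hi hlimit
  · rw [hret]
    exact hc.trans (Nat.le_add_right _ _)
  · obtain ⟨rfl, hguess⟩ := hseq hng hone
    refine ⟨fun k r args v j pt hk => ?_, ?_⟩
    · rw [hC.get] at hk
      split_ifs at hk
      · exact hguess _ _ _ _ _ (Option.some.inj hk)
      · exact hng _ _ _ _ _ _ hk
    · rw [Set.empty_union]
      exact Window.subset_labels_replace hT.symm.subset hfirst hi

theorem stepSimulated_setBuf (hW : Consistent M P C W) (hi : C.buf.get i = some t)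
    (hadv : t.Advances t') {T : Set L} (href : Refines M C i (W.orig i) t' T)
    (hT : T = W.lab i ∪ obsLabels O) (hd : d.isRetire = false)
    (haddr : ∀ src b, t' = .store src (.inr b) → ∃ src₀, t = .store src₀ (.inr b))
    (hval : ∀ v dst, t = .store (.val v) dst → t' = t)
    (hguess : C.NoGuess → W.count ≤ 1 → ∀ r args v j pt, t' ≠ .loadGuess r args v j pt) :
    StepSimulated M P W C d O (C.setBuf i t') := by
  obtain ⟨-, hlimit⟩ := hW.outside i (hi ▸ Option.some_ne_none t)
  have hC : C.Replaced i W.limit t t' (C.setBuf i t') :=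
    .setBuf hi hlimit fun _ => hW.get_eq_none_of_ge
  refine hW.stepSimulated_of_replaced hC hadv le_rfl ?_ href hT le_rfl hd
    (fun k r v dep a pt _ hk _ hl => hl.replaced hC hk.le
      (fun _ src b hb _ => .inr (haddr src b hb))
      fun dst hdst _ hb => ⟨dst, (hval _ _ hdst).trans hdst, hb⟩)
    fun hng hone => ⟨rfl, hguess hng hone⟩
  rw [Function.update_eq_self]
  exact hW.chain

theorem stepSimulated_op (hW : Consistent M P C W) {r : R} {o : Op}
    {args : List (Operand R V L)} {v : LVal V L} (hi : C.buf.get i = some (.op r o args))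
    (hv : EvalTo (M.evalOp o) (C.resolveReg i) args v) :
    StepSimulated M P W C (.exec i) [] (C.setBuf i (.value r v)) := by
  obtain ⟨_, _, horig, hlab, -, -, ⟨⟩⟩ := hW.exists_refines hi
  exact hW.stepSimulated_setBuf hi ⟨rfl, nofun, nofun⟩ (T := ∅) (horig ▸ .value hv)
    (by simp [hlab]) rfl nofun nofun nofun

theorem stepSimulated_jump (hW : Consistent M P C W) {n : LVal V L}
    (hi : C.buf.get i = some t) (hadv : t.Advances (.jump n.val))
    (hstore : ∀ src dst, t ≠ .store src dst)
    (href : Refines M C i (W.orig i) (.jump n.val) {n.lab}) (hlab : W.lab i = ∅) :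
    StepSimulated M P W C (.exec i) [.jump n] (C.setBuf i (.jump n.val)) :=
  hW.stepSimulated_setBuf hi hadv href (by simp [hlab]) rfl nofun
    (fun _ _ h => absurd h (hstore _ _)) nofun

theorem stepSimulated_redirect (hW : Consistent M P C W) {n : LVal V L}
    {t₀ : Transient R V L Op} (hi : C.buf.get i = some t) (hadv : t.Advances (.jump n.val))
    (ht₀ : (W.orig i).retarget n.val = some t₀)
    (href : Refines M C i t₀ (.jump n.val) {n.lab}) (hlab : W.lab i = ∅) :
    StepSimulated M P W C (.exec i) [.rollback, .jump n]
      ((C.rollback i n.val).setBuf i (.jump n.val)) := by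
  obtain ⟨hfirst, hlimit⟩ := hW.outside i (hi ▸ Option.some_ne_none t)
  obtain ⟨c, hc, hchain, hlast⟩ := hW.chain.redirect hfirst hlimit ht₀
  exact hW.stepSimulated_of_replaced (.rollback_self hi n.val) hadv hlimit hchain href
    (by simp [hlab]) hc rfl (fun k _ _ _ _ _ hik hk => by omega) fun _ hone => ⟨hlast hone, nofun⟩

theorem stepSimulated_br (hW : Consistent M P C W) {o : Op} {args : List (Operand R V L)}
    {guess nT nF : V} {n : LVal V L} (hi : C.buf.get i = some (.br o args guess nT nF))
    (hn : EvalTo (M.branchTarget o nT nF) (C.resolveReg i) args n) :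
    (n.val = guess → StepSimulated M P W C (.exec i) [.jump n] (C.setBuf i (.jump n.val))) ∧
      StepSimulated M P W C (.exec i) [.rollback, .jump n]
        ((C.rollback i n.val).setBuf i (.jump n.val)) := by
  obtain ⟨_, _, horig, hlab, -, -, ⟨⟩⟩ := hW.exists_refines hi
  constructor
  · rintro rfl
    exact hW.stepSimulated_jump hi ⟨rfl, nofun, nofun⟩ nofun (horig ▸ .brJump hn) hlab
  · exact hW.stepSimulated_redirect hi ⟨rfl, nofun, nofun⟩ (horig ▸ rfl) (.brJump hn) hlab

theorem stepSimulated_jmpi (hW : Consistent M P C W) {args : List (Operand R V L)} {guess : V}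
    {n : LVal V L} (hi : C.buf.get i = some (.jmpi args guess))
    (hn : EvalTo M.addr (C.resolveReg i) args n) :
    (n.val = guess → StepSimulated M P W C (.exec i) [.jump n] (C.setBuf i (.jump n.val))) ∧
      StepSimulated M P W C (.exec i) [.rollback, .jump n]
        ((C.rollback i n.val).setBuf i (.jump n.val)) := by
  obtain ⟨_, _, horig, hlab, -, -, ⟨⟩⟩ := hW.exists_refines hi
  constructor
  · rintro rfl
    exact hW.stepSimulated_jump hi ⟨rfl, nofun, nofun⟩ nofun (horig ▸ .jmpiJump hn) hlab
  · exact hW.stepSimulated_redirect hi ⟨rfl, nofun, nofun⟩ (horig ▸ rfl) (.jmpiJump hn) hlab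

theorem stepSimulated_load (hW : Consistent M P C W) {r : R} {args : List (Operand R V L)}
    {a v : LVal V L} {dep : WithBot ℕ} {pt : V}
    (hi : C.buf.get i = some (.load r args pt)) (ha : C.ResolvesAddr M i args a)
    (hl : LoadConsistent C i v dep a.val) (hO : obsLabels O = {a.lab}) :
    StepSimulated M P W C (.exec i) O (C.setBuf i (.loaded r v dep a.val pt)) := by
  obtain ⟨_, _, horig, hlab, -, -, ⟨⟩⟩ := hW.exists_refines hi
  exact hW.stepSimulated_setBuf hi ⟨rfl, nofun, nofun⟩ (T := {a.lab})
    (horig ▸ .loaded (Config.resolvesAddr_iff.1 ha) hl) (by simp [hlab, hO]) rfl nofun nofun nofun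

theorem stepSimulated_loadGuess (hW : Consistent M P C W) {r : R} {args : List (Operand R V L)}
    {a v : LVal V L} {j : ℕ} {dep : WithBot ℕ} {pt : V}
    (hi : C.buf.get i = some (.loadGuess r args v j pt)) (ha : C.ResolvesAddr M i args a)
    (hl : LoadConsistent C i v dep a.val) (hO : obsLabels O = {a.lab}) :
    StepSimulated M P W C (.exec i) O (C.setBuf i (.loaded r v dep a.val pt)) := by
  obtain ⟨_, _, horig, hlab, -, -, ⟨⟩⟩ := hW.exists_refines hi
  exact hW.stepSimulated_setBuf hi ⟨rfl, fun _ h => h, nofun⟩ (T := {a.lab})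
    (horig ▸ .loaded (Config.resolvesAddr_iff.1 ha) hl) (by simp [hlab, hO]) rfl nofun nofun nofun

theorem stepSimulated_guess (hW : Consistent M P C W) {r : R} {args : List (Operand R V L)}
    {v : LVal V L} {j : ℕ} {pt : V} {dst : List (Operand R V L) ⊕ LVal V L}
    (hi : C.buf.get i = some (.load r args pt)) (hji : j < i)
    (hj : C.buf.get j = some (.store (.val v) dst)) :
    StepSimulated M P W C (.execFwd i j) [] (C.setBuf i (.loadGuess r args v j pt)) := by
  obtain ⟨_, _, horig, hlab, hfirst, hlimit, ⟨⟩⟩ := hW.exists_refines hi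
  refine hW.stepSimulated_setBuf hi ⟨rfl, nofun, nofun⟩ (T := ∅)
    (horig ▸ .loadGuess hji fun t ht => ⟨dst, Option.some.inj (ht.symm.trans hj)⟩)
    (by simp [hlab]) rfl nofun nofun fun _ hone => ?_
  obtain ⟨_, _, hstore, -, hfirst', hlimit', href⟩ := hW.exists_refines hj
  cases href
  all_goals exact (hW.chain.not_load_and_store_of_count_le_one hone hfirst hlimit hfirst' hlimit'
    horig hstore).elim

theorem stepSimulated_rollback (hW : Consistent M P C W) {r : R} {args : List (Operand R V L)}
    {v : LVal V L} {j : ℕ} {pt : V} (hi : C.buf.get i = some (.loadGuess r args v j pt))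
    (O : List (Obs V L)) :
    StepSimulated M P W C (.exec i) O (C.rollback (C.loadStart i) pt) := by
  obtain ⟨_, _, horig, -, hfirst, hlimit, ⟨⟩⟩ := hW.exists_refines hi
  obtain ⟨c, hc, hchain⟩ := hW.chain_loadStart hfirst hlimit horig
  have hle : C.loadStart i ≤ W.limit := C.loadStart_le.trans hlimit.le
  refine ⟨{ W with limit := C.loadStart i, count := c }, ∅, ⟨hW.rollback hchain hle, .nil _, ?_,
    hc.le.trans (Nat.le_add_right _ _)⟩, fun hng => absurd hi (hng _ _ _ _ _ _)⟩
  rw [Set.empty_union]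
  rintro l ⟨k, hk, hks, hl⟩
  exact .inl ⟨k, hk, hks.trans_le hle, hl⟩

theorem stepSimulated_storeValue (hW : Consistent M P C W) {src : Operand R V L}
    {dst : List (Operand R V L) ⊕ LVal V L} {v : LVal V L}
    (hi : C.buf.get i = some (.store src dst)) (hv : C.resolve i src = some v) :
    StepSimulated M P W C (.execValue i) [] (C.setBuf i (.store (.val v) dst)) := by
  rw [Config.resolve_eq] at hv
  have hval : ∀ w, src = .val w → v = w := by
    rintro w rfl
    exact Option.some.inj hv.symm
  obtain ⟨_, _, horig, hlab, -, -, href⟩ := hW.exists_refines hi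
  refine hW.stepSimulated_setBuf hi ⟨rfl, nofun, ?_⟩ (T := W.lab i) ?_ (by simp) rfl ?_ ?_ nofun
  · rintro w _ ⟨⟩
    exact ⟨dst, hval w rfl ▸ rfl⟩
  · rw [horig, hlab]
    cases href with
    | store hs => exact .store (.inr ⟨v, hs.eval_eq hv, rfl⟩)
    | storeAddr hs ha => exact .storeAddr (.inr ⟨v, hs.eval_eq hv, rfl⟩) ha
  · rintro _ b ⟨⟩
    exact ⟨src, rfl⟩
  · rintro w _ ⟨⟩
    rw [hval w rfl]

theorem stepSimulated_storeAddr (hW : Consistent M P C W) {src : Operand R V L}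
    {args : List (Operand R V L)} {a : LVal V L} {c : ℕ}
    (hC : C.Replaced i limit (.store src (.inl args)) (.store src (.inr a)) C')
    (hlimit : limit ≤ W.limit) (hchain : Chain M P W.orig W.first W.pc limit C'.pc c)
    (hc : c ≤ W.count) (hone : W.count ≤ 1 → limit = W.limit) (ha : C.ResolvesAddr M i args a)
    (hhaz : ∀ k < limit, ¬ C.Hazard i a.val k) (hO : obsLabels O = {a.lab}) :
    StepSimulated M P W C (.execAddr i) O C' := by
  obtain ⟨_, _, horig, hlab, -, -, ⟨⟩⟩ := hW.exists_refines hC.old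
  rename_i src₀ hs
  refine hW.stepSimulated_of_replaced hC ⟨rfl, nofun, ?_⟩ hlimit (t₀ := W.orig i) (T := {a.lab}) ?_
    (horig ▸ .storeAddr hs (Config.resolvesAddr_iff.1 ha)) (by simp [hlab, hO]) hc rfl
    (fun k r v dep b pt _ hk hload hl => hl.replaced_storeAddr hC hk.le hload (hhaz k hk))
    fun _ h => ⟨hone h, nofun⟩
  · rintro v _ ⟨⟩
    exact ⟨_, rfl⟩
  · rwa [Function.update_eq_self]

theorem stepSimulated_storeAddr_ok (hW : Consistent M P C W) {src : Operand R V L}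
    {args : List (Operand R V L)} {a : LVal V L}
    (hi : C.buf.get i = some (.store src (.inl args))) (ha : C.ResolvesAddr M i args a)
    (hhaz : ∀ k, ¬ C.Hazard i a.val k) :
    StepSimulated M P W C (.execAddr i) [.fwd a] (C.setBuf i (.store src (.inr a))) :=
  hW.stepSimulated_storeAddr
    (.setBuf hi (hW.outside i (hi ▸ Option.some_ne_none _)).2 fun _ => hW.get_eq_none_of_ge)
    le_rfl hW.chain le_rfl (fun _ => rfl) ha (fun k _ => hhaz k) (obsLabels_fwd a)

theorem stepSimulated_storeAddr_hazard (hW : Consistent M P C W) {src : Operand R V L}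
    {args : List (Operand R V L)} {a : LVal V L} {k : ℕ} {r : R} {v : LVal V L}
    {dep : WithBot ℕ} {b pt : V} (hi : C.buf.get i = some (.store src (.inl args)))
    (ha : C.ResolvesAddr M i args a) (hk : IsLeast {k | C.Hazard i a.val k} k)
    (hload : C.buf.get k = some (.loaded r v dep b pt)) :
    StepSimulated M P W C (.execAddr i) [.rollback, .fwd a]
      ((C.rollback (C.loadStart k) pt).setBuf i (.store src (.inr a))) := by
  obtain ⟨_, _, horig, -, hfirst, hlimit, ⟨⟩⟩ := hW.exists_refines hload
  obtain ⟨_, _, hstore, -, hfirst', hlimit', ⟨⟩⟩ := hW.exists_refines hi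
  obtain ⟨c, hc, hchain⟩ := hW.chain_loadStart hfirst hlimit horig
  have hlt : i < C.loadStart k := C.lt_loadStart hk.1.1 (by simp [hi])
  refine hW.stepSimulated_storeAddr (.rollback hi hlt pt) (C.loadStart_le.trans hlimit.le) hchain
    hc.le (fun hone => ?_) ha (fun j hj hhaz => ?_)
    ((obsLabels_rollback _).trans (obsLabels_fwd a))
  · exact absurd hstore
      (hW.chain.not_load_and_store_of_count_le_one hone hfirst hlimit hfirst' hlimit' horig)
  · exact (hj.trans_le C.loadStart_le).not_ge (hk.2 hhaz)

theorem stepSimulated_exec (hW : Consistent M P C W) (h : Step M P C (.exec i) O C') :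
    StepSimulated M P W C (.exec i) O C' := by
  cases h with
  | op_execute _ _ _ _ _ _ hi _ hvs hv => exact hW.stepSimulated_op hi (hvs.evalTo hv)
  | br_execute_correct _ o args _ nT nF vs b hi _ hvs hb hguess =>
    exact (hW.stepSimulated_br hi (hvs.evalTo (by simp [Machine.branchTarget, hb, hguess]))).1 rfl
  | br_execute_incorrect _ o args _ nT nF vs b n hi _ hvs hb hn _ =>
    exact (hW.stepSimulated_br hi (hvs.evalTo (by simp [Machine.branchTarget, hb, hn]))).2
  | jmpi_execute_correct _ _ _ n hi _ hn hguess =>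
    subst hguess
    exact (hW.stepSimulated_jmpi hi (Config.resolvesAddr_iff.1 hn)).1 rfl
  | jmpi_execute_incorrect _ _ _ n hi _ hn _ =>
    exact (hW.stepSimulated_jmpi hi (Config.resolvesAddr_iff.1 hn)).2
  | load_execute_forward _ j _ _ _ a b v hi _ ha hj hv =>
    refine hW.stepSimulated_load hi ha (.of_store hj.1.1 hv ?_ fun k hjk hki hs => ?_)
      (obsLabels_fwd a)
    · rintro _ ⟨⟩
      obtain ⟨_, _, hb, hba⟩ := hj.1.2
      cases hb.symm.trans hv
      exact hba
    · exact hjk.not_ge (hj.2 ⟨hki, hs⟩)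
  | load_execute_nodep _ _ _ _ a v hi _ ha hj hv =>
    exact hW.stepSimulated_load hi ha (.of_mem hj hv) (obsLabels_read a)
  | load_execute_addr_ok _ j _ _ _ a v dst hi _ ha hj hdst hk =>
    obtain ⟨_, _, -, -, -, -, ⟨⟩⟩ := hW.exists_refines hi
    rename_i hji _
    exact hW.stepSimulated_loadGuess hi ha (.of_store hji hj hdst hk) (obsLabels_fwd a)
  | load_execute_addr_hazard _ _ _ _ _ _ _ hi => exact hW.stepSimulated_rollback hi _
  | load_execute_mem_match _ _ _ _ _ a v hi _ ha _ hk hv =>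
    exact hW.stepSimulated_loadGuess hi ha (.of_mem hk hv) (obsLabels_read a)
  | load_execute_mem_hazard _ _ _ _ _ _ _ _ hi => exact hW.stepSimulated_rollback hi _

end Consistent

end Simulation

/-! ### Simulation by the in-order machine: fetch steps -/

namespace Config

/-- `C'` arises from `C` by appending the entries `ts` to the buffer. -/
structure Appends (C : Config R V L Op) (ts : List (Transient R V L Op)) (C' : Config R V L Op) :
    Prop where
  reg : C'.reg = C.reg
  mem : C'.mem = C.mem
  get : ∀ k, C'.buf.get k = if k < C.fresh then C.buf.get k else ts[k - C.fresh]?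

theorem get_eq_none_of_fresh_le {C : Config R V L Op} {k : ℕ} (hk : C.fresh ≤ k) :
    C.buf.get k = none :=
  not_not.1 fun hne => (Finset.le_sup (f := id) (FMap.mem_dom.2 hne)).not_gt hk

variable {C C' : Config R V L Op}

theorem Appends.single {t : Transient R V L Op} (hreg : C'.reg = C.reg) (hmem : C'.mem = C.mem)
    (hbuf : C'.buf = C.buf.set C.fresh t) : C.Appends [t] C' where
  reg := hreg
  mem := hmem
  get k := by grind [FMap.get_set, C.get_eq_none_of_fresh_le]

theorem Appends.triple {t₀ t₁ t₂ : Transient R V L Op} (hreg : C'.reg = C.reg)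
    (hmem : C'.mem = C.mem)
    (hbuf : C'.buf = ((C.buf.set C.fresh t₀).set (C.fresh + 1) t₁).set (C.fresh + 2) t₂) :
    C.Appends [t₀, t₁, t₂] C' where
  reg := hreg
  mem := hmem
  get k := by grind [FMap.get_set, C.get_eq_none_of_fresh_le]

theorem Appends.quadruple {t₀ t₁ t₂ t₃ : Transient R V L Op} (hreg : C'.reg = C.reg)
    (hmem : C'.mem = C.mem)
    (hbuf : C'.buf = (((C.buf.set C.fresh t₀).set (C.fresh + 1) t₁).set (C.fresh + 2) t₂).set
      (C.fresh + 3) t₃) :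
    C.Appends [t₀, t₁, t₂, t₃] C' where
  reg := hreg
  mem := hmem
  get k := by grind [FMap.get_set, C.get_eq_none_of_fresh_le]

end Config

theorem Fetched.refines [Lattice L] [OrderBot L] {M : Machine R V Op} {P : Program R V L Op}
    {C : Config R V L Op} {n m : V} {k : ℕ} {t : Transient R V L Op}
    {ts : List (Transient R V L Op)} (h : Fetched M P n ts m) (ht : t ∈ ts) :
    Refines M C k t t ∅ := by
  cases h <;> simp only [List.mem_cons, List.not_mem_nil, or_false] at ht
  case call =>
    rcases ht with rfl | rfl | rfl
    exacts [.call, .op _ _ _, .store (.inl rfl)]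
  case ret =>
    rcases ht with rfl | rfl | rfl | rfl
    exacts [.ret, .load _ _ _, .op _ _ _, .jmpi _ _]
  all_goals subst ht
  exacts [.op _ _ _, .br _ _ _ _ _, .load _ _ _, .store (.inl rfl), .jmpi _ _, .fence]

namespace Window

/-- The ghost state after fetching an instruction as the entries `ts`. -/
def append (W : Window R V L Op) (ts : List (Transient R V L Op)) : Window R V L Op :=
  { W with
    orig := fun k => if k < W.limit then W.orig k else (ts[k - W.limit]?).getD .fence
    lab := fun k => if k < W.limit then W.lab k else ∅
    limit := W.limit + ts.length
    count := W.count + 1 }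

theorem labels_append (W : Window R V L Op) (ts : List (Transient R V L Op)) :
    (W.append ts).labels = W.labels := by
  ext l
  constructor
  · rintro ⟨k, hk, -, hl⟩
    simp only [append] at hl
    split_ifs at hl with hks
    · exact ⟨k, hk, hks, hl⟩
    · exact hl.elim
  · rintro ⟨k, hk, hks, hl⟩
    exact ⟨k, hk, hks.trans_le (Nat.le_add_right _ _), by simpa only [append, if_pos hks] using hl⟩

end Window

namespace Consistent

variable [Lattice L] [OrderBot L] {M : Machine R V Op} {P : Program R V L Op}
  {C C' : Config R V L Op} {W : Window R V L Op}

theorem exists_limit_eq_fresh (hW : Consistent M P C W) :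
    ∃ W', Consistent M P C W' ∧ W'.limit = C.fresh ∧ W'.count = W.count ∧ W'.pc = W.pc ∧
      W'.labels = W.labels := by
  rcases hW.chain.le.lt_or_eq with hlt | heq
  · exact ⟨W, hW, (FMap.maxIdx_add_one hlt fun _ => hW.get_ne_none_iff).symm, rfl, rfl, rfl⟩
  obtain ⟨hcount, hpc⟩ := (heq ▸ hW.chain).count_eq_zero
  refine ⟨{ W with first := C.fresh, limit := C.fresh }, ⟨?_, fun k hk hk' => ?_, fun k hk => ?_⟩,
    rfl, rfl, rfl, ?_⟩
  · rw [hcount, hpc]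
    exact .nil _ _
  · exact absurd hk' hk.not_gt
  · have := hW.outside k hk
    omega
  · rw [Window.labels_eq_empty le_rfl, Window.labels_eq_empty heq.ge]

theorem appends {ts : List (Transient R V L Op)} (hW : Consistent M P C W)
    (hlimit : W.limit = C.fresh) (hts : Fetched M P C.pc ts C'.pc) (hC : C.Appends ts C') :
    Consistent M P C' (W.append ts) where
  chain := by
    refine Chain.snoc (hW.chain.congr fun k _ hk => if_pos hk) (fun k hk => ?_) hts
    simp [Window.append, hk]
  outside k hk := by
    have := hW.chain.le
    rw [hC.get, ← hlimit] at hk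
    split_ifs at hk with hks
    · exact ⟨(hW.outside k hk).1, hks.trans_le (Nat.le_add_right _ _)⟩
    · have hlt : k - W.limit < ts.length := by
        by_contra hge
        exact hk (List.getElem?_eq_none (by omega))
      change W.first ≤ k ∧ k < W.limit + ts.length
      omega
  entry k hfirst hk := by
    change k < W.limit + ts.length at hk
    rw [hC.get, ← hlimit]
    simp only [Window.append]
    split_ifs with hks
    · obtain ⟨t, ht, href⟩ := hW.entry k hfirst hks
      refine ⟨t, ht, href.congr hC.reg hC.mem fun j hj => ?_⟩
      rw [hC.get, if_pos (by omega)]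
    · have hlt : k - W.limit < ts.length := by omega
      rw [List.getElem?_eq_getElem hlt]
      exact ⟨_, rfl, hts.refines (List.getElem_mem hlt)⟩

end Consistent

section Fetch

variable [DecidableEq R] [DecidableEq V] [Lattice L] [OrderBot L] {M : Machine R V Op}
  {P : Program R V L Op} {C C' : Config R V L Op} {W : Window R V L Op} {d : Directive V}
  {O : List (Obs V L)}

theorem Step.exists_fetched (h : Step M P C d O C') (hd : d.isFetch) :
    ∃ ts, Fetched M P C.pc ts C'.pc ∧ C.Appends ts C' ∧ O = [] := by
  cases h with
  | op_fetch _ _ _ _ hP => exact ⟨_, .op hP, .single rfl rfl rfl, rfl⟩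
  | load_fetch _ _ _ hP => exact ⟨_, .load hP, .single rfl rfl rfl, rfl⟩
  | store_fetch _ _ _ hP => exact ⟨_, .store hP, .single rfl rfl rfl, rfl⟩
  | fence_fetch _ hP => exact ⟨_, .fence hP, .single rfl rfl rfl, rfl⟩
  | br_fetch _ _ _ _ _ hP => exact ⟨_, .br _ hP, .single rfl rfl rfl, rfl⟩
  | jmpi_fetch _ _ hP => exact ⟨_, .jmpi _ hP, .single rfl rfl rfl, rfl⟩
  | call_fetch _ _ hP => exact ⟨_, .call hP, .triple rfl rfl rfl, rfl⟩
  | ret_fetch_rsb _ hP => exact ⟨_, .ret _ hP, .quadruple rfl rfl rfl, rfl⟩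
  | ret_fetch_rsb_empty _ hP => exact ⟨_, .ret _ hP, .quadruple rfl rfl rfl, rfl⟩
  | _ => cases hd

theorem Consistent.stepSimulated_fetch (hW : Consistent M P C W) (h : Step M P C d O C')
    (hd : d.isFetch) : StepSimulated M P W C d O C' := by
  obtain ⟨ts, hts, hC, rfl⟩ := h.exists_fetched hd
  obtain ⟨W₁, hW₁, hlimit, hcount, hpc, hlabels⟩ := hW.exists_limit_eq_fresh
  have hret : numRetired [d] = 0 := by cases d <;> first | rfl | cases hd
  have hlab : (W₁.append ts).labels = W.labels := (W₁.labels_append ts).trans hlabels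
  refine ⟨W₁.append ts, ∅, ⟨hW₁.appends hlimit hts hC, ?_, ?_, ?_⟩, fun hng _ _ => ⟨?_, ?_⟩⟩
  · rw [hret, hC.reg, hC.mem, ← hpc]
    exact .nil _
  · rw [hlab, Set.empty_union]
    exact Set.subset_union_left
  · simp [hret, hcount, hd, Window.append]
  · intro k r args v j pt hk
    rw [hC.get] at hk
    split_ifs at hk
    · exact hng k r args v j pt hk
    · nomatch hts.refines (M := M) (C := C) (k := k) (List.mem_of_getElem? hk)
  · rw [hlab, obsLabels_nil, Set.union_empty, Set.empty_union]

end Fetch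

/-! ### Simulation by the in-order machine: retire steps -/

namespace Window

/-- The ghost state after retiring the oldest instruction, which occupies `len` indices. -/
def drop (W : Window R V L Op) (len : ℕ) (n : V) (c : ℕ) : Window R V L Op :=
  { W with first := W.first + len, pc := n, count := c }

/-- The labels exposed by the first `len` entries. -/
def headLabels (W : Window R V L Op) (len : ℕ) : Set L := {l | ∃ k < len, l ∈ W.lab (W.first + k)}

theorem headLabels_zero (W : Window R V L Op) : W.headLabels 0 = ∅ := by
  simp [headLabels]

theorem headLabels_succ (W : Window R V L Op) (len : ℕ) :
    W.headLabels (len + 1) = W.headLabels len ∪ W.lab (W.first + len) := by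
  ext l
  exact Nat.exists_lt_succ_right

theorem labels_eq_headLabels_union (W : Window R V L Op) {len : ℕ} (h : W.first + len ≤ W.limit)
    (n : V) (c : ℕ) : W.labels = W.headLabels len ∪ (W.drop len n c).labels := by
  ext l
  constructor
  · rintro ⟨k, hk, hks, hl⟩
    by_cases hlen : k < W.first + len
    · exact .inl ⟨k - W.first, by omega, by rwa [Nat.add_sub_cancel' hk]⟩
    · exact .inr ⟨k, not_lt.1 hlen, hks, hl⟩
  · rintro (⟨k, hk, hl⟩ | ⟨k, hk, hks, hl⟩)
    · exact ⟨W.first + k, by omega, by omega, hl⟩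
    · exact ⟨k, (Nat.le_add_right _ _).trans hk, hks, hl⟩

end Window

section Retire

variable [Lattice L] [OrderBot L] {M : Machine R V Op} {P : Program R V L Op}
  {C C' : Config R V L Op} {W : Window R V L Op} {t : Transient R V L Op}

namespace Refines

theorem of_load {k : ℕ} {r r' : R} {args : List (Operand R V L)} {pt : V} {v : LVal V L}
    {T : Set L} (h : Refines M C k (.load r args pt) t T) (ht : t.IsValue r' v) :
    ∃ a dep, EvalTo M.addr (C.resolveReg k) args a ∧ LoadConsistent C k v dep a.val ∧
      T = {a.lab} := by
  cases ht with
  | value => cases h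
  | loaded => cases h with | loaded ha hl => exact ⟨_, _, ha, hl, rfl⟩

theorem of_op {k : ℕ} {r r' : R} {o : Op} {args : List (Operand R V L)} {v : LVal V L}
    {T : Set L} (h : Refines M C k (.op r o args) t T) (ht : t.IsValue r' v) :
    EvalTo (M.evalOp o) (C.resolveReg k) args v ∧ T = ∅ := by
  cases ht with
  | value => cases h with | value hv => exact ⟨hv, rfl⟩
  | loaded => cases h

end Refines

namespace Consistent

theorem eq_first_of_retirable {i : ℕ} (hW : Consistent M P C W) (hi : C.Retirable i)
    (ht : C.buf.get i = some t) : i = W.first := by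
  obtain ⟨hfirst, hlimit⟩ := hW.outside i (ht ▸ Option.some_ne_none t)
  refine hi.symm.trans (FMap.minIdx_eq ?_ fun k hk => (hW.outside k hk).1)
  exact hW.get_ne_none_iff.2 ⟨le_rfl, hfirst.trans_lt hlimit⟩

theorem resolveReg_first (hW : Consistent M P C W) : C.resolveReg W.first = C.reg :=
  Config.resolveReg_eq_reg fun _ => hW.get_eq_none_of_lt

theorem exists_fetched_first (hW : Consistent M P C W) (hi : C.buf.get W.first ≠ none) :
    ∃ ts q c, Fetched M P W.pc ts q ∧ ListsFrom W.orig W.first ts ∧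
      Chain M P W.orig (W.first + ts.length) q W.limit C.pc c ∧ W.count = c + 1 := by
  obtain ⟨-, hlt⟩ := hW.outside _ hi
  have hchain := hW.chain
  rcases W with ⟨orig, lab, first, limit, count, pc⟩
  generalize C.pc = m at hchain
  cases hchain with
  | nil => exact absurd hlt (lt_irrefl _)
  | cons hts hfetch hrest => exact ⟨_, _, _, hfetch, hts, hrest, rfl⟩

/-- Retiring commits all registers but `M.rret`. The entries that remain do not notice this: they
read `M.rret` only after a load of their own return instruction has assigned it. -/
theorem commits {len c : ℕ} {n : V} (hP : P.NotRead M.rret) (hW : Consistent M P C W)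
    (hC : C.Commits M (W.first + len) C')
    (hchain : Chain M P W.orig (W.first + len) n W.limit C.pc c) :
    Consistent M P C' (W.drop len n c) where
  chain := hC.pc ▸ hchain
  outside k hk := by
    rw [hC.get] at hk
    split_ifs at hk with hle
    · exact ⟨hle, (hW.outside k hk).2⟩
    · exact absurd rfl hk
  entry k hfirst hlimit := by
    change W.first + len ≤ k at hfirst
    change k < W.limit at hlimit
    have get_eq {j : ℕ} (hj : W.first + len ≤ j) : C'.buf.get j = C.buf.get j := by
      rw [hC.get, if_pos hj]
    obtain ⟨t, ht, href⟩ := hW.entry k (by omega) hlimit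
    refine ⟨t, (get_eq hfirst).trans ht, href.mono (fun r hr v hv => ?_)
      (fun r v dep a pt _ hl => hl.commits hC hfirst) fun j _ v hs u hu => ?_⟩
    · refine Config.resolveReg_mono hfirst (fun hnot w hw => ?_) (fun j hj hjk => ?_) hv
      · rw [Config.resolveReg_eq_reg fun j hj => by rw [hC.get, if_neg (by omega)], hC.reg, hw]
        rintro rfl
        obtain ⟨j, pt, hj, hjk, hload⟩ := hchain.exists_load_rret hP hfirst hlimit hr
        obtain ⟨u, hu, hru⟩ := hW.entry j (by omega) (hjk.trans hlimit)
        exact hnot j hj hjk ⟨u, hu, by rw [hru.target_eq, hload]; rfl⟩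
      · obtain ⟨u, hu, -⟩ := hW.entry j (by omega) (hjk.trans hlimit)
        exact ⟨u, u, hu, (get_eq hj).trans hu, .refl u⟩
    · rw [hC.get] at hu
      split_ifs at hu
      exact hs u hu

theorem resolveReg_of_call [DecidableEq R] (hW : Consistent M P C W) {sp v a : LVal V L}
    (hi : C.buf.get W.first = some .call) (hsp : C.buf.get (W.first + 1) = some (.value M.rsp sp))
    (hst : C.buf.get (W.first + 2) = some (.store (.val v) (.inr a))) :
    C.resolveReg (W.first + 1) = C.reg ∧
      C.resolveReg (W.first + 2) = Function.update C.reg M.rsp (some sp) ∧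
      C.resolveReg (W.first + 3) = Function.update C.reg M.rsp (some sp) := by
  have hreg₁ : C.resolveReg (W.first + 1) = C.reg := by
    rw [Config.resolveReg_succ_of_get hi, hW.resolveReg_first]
    exact Transient.assign_of_target_eq_none _ rfl
  have hreg₂ : C.resolveReg (W.first + 2) = Function.update C.reg M.rsp (some sp) := by
    rw [Config.resolveReg_succ_of_get hsp, hreg₁]
    exact Transient.assign_of_target_eq_some _ rfl
  refine ⟨hreg₁, hreg₂, ?_⟩
  rw [Config.resolveReg_succ_of_get hst, hreg₂]
  exact Transient.assign_of_target_eq_none _ rfl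

theorem headLabels_of_call (hW : Consistent M P C W) {sp v a : LVal V L}
    (hi : C.buf.get W.first = some .call) (hsp : C.buf.get (W.first + 1) = some (.value M.rsp sp))
    (hst : C.buf.get (W.first + 2) = some (.store (.val v) (.inr a))) :
    W.headLabels 3 = {a.lab} := by
  obtain ⟨_, _, -, hT₀, -, -, href₀⟩ := hW.exists_refines hi
  obtain ⟨_, _, -, hT₁, -, -, href₁⟩ := hW.exists_refines hsp
  obtain ⟨_, _, -, hT₂, -, -, href₂⟩ := hW.exists_refines hst
  cases href₀
  cases href₁
  cases href₂
  simp only [W.headLabels_succ, W.headLabels_zero, Nat.add_zero, hT₀, hT₁, hT₂, Set.empty_union]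

theorem resolveReg_of_ret [DecidableEq R] (hW : Consistent M P C W)
    {t₁ t₂ : Transient R V L Op} {w sp : LVal V L} (hi : C.buf.get W.first = some .ret)
    (h₁ : C.buf.get (W.first + 1) = some t₁) (ht₁ : t₁.IsValue M.rret w)
    (h₂ : C.buf.get (W.first + 2) = some t₂) (ht₂ : t₂.IsValue M.rsp sp) :
    C.resolveReg (W.first + 1) = C.reg ∧
      C.resolveReg (W.first + 2) = Function.update C.reg M.rret (some w) ∧
      C.resolveReg (W.first + 3) =
        Function.update (Function.update C.reg M.rret (some w)) M.rsp (some sp) := by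
  have hreg₁ : C.resolveReg (W.first + 1) = C.reg := by
    rw [Config.resolveReg_succ_of_get hi, hW.resolveReg_first]
    exact Transient.assign_of_target_eq_none _ rfl
  have hreg₂ : C.resolveReg (W.first + 2) = Function.update C.reg M.rret (some w) := by
    rw [Config.resolveReg_succ_of_get h₁, hreg₁, ← ht₁.result_eq]
    exact Transient.assign_of_target_eq_some _ ht₁.target_eq
  refine ⟨hreg₁, hreg₂, ?_⟩
  rw [Config.resolveReg_succ_of_get h₂, hreg₂, ← ht₂.result_eq]
  exact Transient.assign_of_target_eq_some _ ht₂.target_eq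

theorem commits_erase [DecidableEq V] (hW : Consistent M P C W)
    (hi : C.buf.get W.first = some t) (hpc : C'.pc = C.pc) (hbuf : C'.buf = C.buf.erase W.first)
    (hreg : C'.reg = t.assign C.reg)
    (hmem : (∀ src dst, t ≠ .store src dst) ∧ C'.mem = C.mem ∨
      ∃ v a, t = .store (.val v) (.inr a) ∧ C'.mem = Function.update C.mem a.val (some v)) :
    C.Commits M (W.first + 1) C' where
  pc := hpc
  get k := by
    rw [hbuf, FMap.get_erase]
    rcases lt_trichotomy k W.first with hlt | rfl | hgt
    · rw [if_pos hlt.ne, if_neg (by omega), hW.get_eq_none_of_lt hlt]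
    · simp
    · rw [if_pos hgt.ne', if_pos (by omega)]
  reg r _ := by rw [hreg, Config.resolveReg_succ_of_get hi, hW.resolveReg_first]
  store j hj src dst hs := by
    rcases Nat.lt_succ_iff_lt_or_eq.1 hj with hlt | rfl
    · cases (hW.get_eq_none_of_lt hlt).symm.trans hs
    obtain rfl := Option.some.inj (hi.symm.trans hs)
    rcases hmem with ⟨hne, -⟩ | ⟨v, a, ht, hmem⟩
    · exact absurd rfl (hne src dst)
    · cases ht
      exact ⟨v, a, rfl, rfl, by rw [hmem, Function.update_self]⟩
  mem b hb := by
    rcases hmem with ⟨-, hmem⟩ | ⟨v, a, rfl, hmem⟩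
    · exact absurd (congrFun hmem b) hb
    refine ⟨W.first, Nat.lt_succ_self _, _, a, hi, ?_⟩
    by_contra hne
    exact hb (by rw [hmem, Function.update_of_ne (Ne.symm hne)])

end Consistent

end Retire

section StepRetire

variable [DecidableEq R] [DecidableEq V] [Lattice L] [OrderBot L] {M : Machine R V Op}
  {P : Program R V L Op} {C C' : Config R V L Op} {W : Window R V L Op} {d : Directive V}
  {O : List (Obs V L)} {t : Transient R V L Op}

namespace Consistent

theorem stepSimulated_of_commits {len : ℕ} (hP : P.NotRead M.rret) (hW : Consistent M P C W)
    (hi : C.buf.get W.first ≠ none) (hC : C.Commits M (W.first + len) C')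
    (hstep : ∀ ts q, Fetched M P W.pc ts q → ListsFrom W.orig W.first ts → ts.length = len ∧
      ArchStep M P ⟨C.reg, C.mem, W.pc⟩ (W.headLabels len) ⟨C'.reg, C'.mem, q⟩)
    (hO : obsLabels O ⊆ W.headLabels len) : StepSimulated M P W C .retire O C' := by
  obtain ⟨ts, q, c, hts, hlists, hchain, hc⟩ := hW.exists_fetched_first hi
  obtain ⟨rfl, harch⟩ := hstep ts q hts hlists
  have hlabels := W.labels_eq_headLabels_union hchain.le q c
  refine ⟨W.drop ts.length q c, W.headLabels ts.length,
    ⟨hW.commits hP hC hchain, .single harch, ?_, hc.ge⟩, fun hng _ _ => ⟨?_, ?_⟩⟩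
  · rw [← hlabels]
    exact Set.subset_union_left
  · intro k r args v j pt hk
    rw [hC.get] at hk
    split_ifs at hk
    exact hng k r args v j pt hk
  · rw [← hlabels]
    exact Set.union_subset le_rfl (hO.trans (hlabels ▸ Set.subset_union_left))

theorem stepSimulated_retire_single (hP : P.NotRead M.rret) (hW : Consistent M P C W)
    (hi : C.buf.get W.first = some t) (hC : C.Commits M (W.first + 1) C')
    (hstep : ∀ t₀ T ts q, Refines M C W.first t₀ t T → Fetched M P W.pc (t₀ :: ts) q →
      ts = [] ∧ obsLabels O ⊆ T ∧ ArchStep M P ⟨C.reg, C.mem, W.pc⟩ T ⟨C'.reg, C'.mem, q⟩) :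
    StepSimulated M P W C .retire O C' := by
  obtain ⟨_, T, rfl, hT, -, -, href⟩ := hW.exists_refines hi
  have hlabels : W.headLabels 1 = T := by
    rw [W.headLabels_succ, W.headLabels_zero, Set.empty_union, Nat.add_zero, hT]
  have step : ∀ ts q, Fetched M P W.pc ts q → ListsFrom W.orig W.first ts → ts.length = 1 ∧
      obsLabels O ⊆ T ∧ ArchStep M P ⟨C.reg, C.mem, W.pc⟩ T ⟨C'.reg, C'.mem, q⟩ := by
    intro ts q hts hlists
    rcases ts with _ | ⟨t₀, ts⟩
    · cases hts
    obtain rfl : t₀ = W.orig W.first := Option.some.inj (hlists 0 (Nat.succ_pos _))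
    obtain ⟨rfl, h⟩ := hstep _ T ts q href hts
    exact ⟨rfl, h⟩
  obtain ⟨ts, q, c, hts, hlists, -, -⟩ := hW.exists_fetched_first (hi ▸ Option.some_ne_none t)
  refine hW.stepSimulated_of_commits hP (hi ▸ Option.some_ne_none t) hC
    (fun ts q hts hlists => ?_) ?_
  · obtain ⟨hlen, -, harch⟩ := step ts q hts hlists
    exact ⟨hlen, hlabels ▸ harch⟩
  · exact hlabels ▸ (step ts q hts hlists).2.1

theorem stepSimulated_value_retire (hP : P.NotRead M.rret) (hW : Consistent M P C W) {r : R}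
    {v : LVal V L} (hi : C.buf.get W.first = some t) (ht : t.IsValue r v) :
    StepSimulated M P W C .retire []
      { C with reg := Function.update C.reg r (some v), buf := C.buf.erase W.first } := by
  have hne : ∀ src dst, t ≠ .store src dst := by
    rintro src dst rfl
    cases ht
  refine hW.stepSimulated_retire_single hP hi (hW.commits_erase hi rfl rfl ?_ (.inl ⟨hne, rfl⟩)) ?_
  · rw [t.assign_of_target_eq_some _ ht.target_eq, ht.result_eq]
  intro t₀ T ts q href hts
  cases ht with
  | value => cases href with | value hv =>
    cases hts with | op hPC =>
    rw [hW.resolveReg_first] at hv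
    exact ⟨rfl, by simp, _, hPC, .op hv⟩
  | loaded => cases href with | loaded ha hl =>
    cases hts with | load hPC =>
    rw [hW.resolveReg_first] at ha
    refine ⟨rfl, by simp, _, hPC, .load ha (hl.mem_eq fun j hj src dst => ?_)⟩
    rw [hW.get_eq_none_of_lt hj]
    nofun

theorem stepSimulated_jump_retire (hP : P.NotRead M.rret) (hW : Consistent M P C W) {n : V}
    (hi : C.buf.get W.first = some (.jump n)) :
    StepSimulated M P W C .retire [] { C with buf := C.buf.erase W.first } := by
  refine hW.stepSimulated_retire_single hP hi
    (hW.commits_erase hi rfl rfl (Transient.assign_of_target_eq_none _ rfl).symm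
      (.inl ⟨nofun, rfl⟩)) fun t₀ T ts q href hts => ?_
  cases href with
  | brJump hn =>
    cases hts with | br _ hPC =>
    rw [hW.resolveReg_first] at hn
    exact ⟨rfl, by simp, _, hPC, .br hn⟩
  | jmpiJump hn =>
    cases hts with | jmpi _ hPC =>
    rw [hW.resolveReg_first] at hn
    exact ⟨rfl, by simp, _, hPC, .jmpi hn⟩

theorem stepSimulated_fence_retire (hP : P.NotRead M.rret) (hW : Consistent M P C W)
    (hi : C.buf.get W.first = some .fence) :
    StepSimulated M P W C .retire [] { C with buf := C.buf.erase W.first } := by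
  refine hW.stepSimulated_retire_single hP hi
    (hW.commits_erase hi rfl rfl (Transient.assign_of_target_eq_none _ rfl).symm
      (.inl ⟨nofun, rfl⟩)) fun t₀ T ts q href hts => ?_
  cases href
  cases hts with | fence hPC =>
  exact ⟨rfl, by simp, _, hPC, .fence⟩

theorem stepSimulated_store_retire (hP : P.NotRead M.rret) (hW : Consistent M P C W)
    {v a : LVal V L} (hi : C.buf.get W.first = some (.store (.val v) (.inr a))) :
    StepSimulated M P W C .retire [.write a]
      { C with mem := Function.update C.mem a.val (some v), buf := C.buf.erase W.first } := by
  refine hW.stepSimulated_retire_single hP hi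
    (hW.commits_erase hi rfl rfl (Transient.assign_of_target_eq_none _ rfl).symm
      (.inr ⟨v, a, rfl, rfl⟩)) fun t₀ T ts q href hts => ?_
  cases href with | storeAddr hs ha =>
  cases hts with | store hPC =>
  rw [hW.resolveReg_first] at hs ha
  exact ⟨rfl, (obsLabels_write a).subset, _, hPC, .store ha (hs.eval_eq rfl)⟩

theorem archStep_call (hW : Consistent M P C W) {sp v a : LVal V L} {q : V}
    {ts : List (Transient R V L Op)} (hi : C.buf.get W.first = some .call)
    (hsp : C.buf.get (W.first + 1) = some (.value M.rsp sp))
    (hst : C.buf.get (W.first + 2) = some (.store (.val v) (.inr a)))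
    (hts : Fetched M P W.pc ts q) (hlists : ListsFrom W.orig W.first ts) :
    ts.length = 3 ∧ ArchStep M P ⟨C.reg, C.mem, W.pc⟩ (W.headLabels 3)
      ⟨Function.update C.reg M.rsp (some sp), Function.update C.mem a.val (some v), q⟩ := by
  obtain ⟨hreg₁, hreg₂, -⟩ := hW.resolveReg_of_call hi hsp hst
  obtain ⟨_, _, horig, -, -, -, href⟩ := hW.exists_refines hi
  obtain ⟨_, _, horig₁, -, -, -, href₁⟩ := hW.exists_refines hsp
  obtain ⟨_, _, horig₂, -, -, -, href₂⟩ := hW.exists_refines hst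
  cases href
  obtain ⟨nret, hPC, rfl⟩ := hts.eq_call (by rw [hlists 0 hts.length_pos, Nat.add_zero, horig])
  cases (hlists 1 (by simp)).trans (congrArg some horig₁)
  cases (hlists 2 (by simp)).trans (congrArg some horig₂)
  cases href₁ with | value hv =>
  cases href₂ with | storeAddr hs ha =>
  rw [hreg₁] at hv
  rw [hreg₂, EvalTo.reg_iff_val (Function.update_self _ _ _)] at ha
  cases hs.eval_eq rfl
  rw [hW.headLabels_of_call hi hsp hst]
  exact ⟨rfl, _, hPC, .call hv ha⟩

theorem stepSimulated_call_retire (hP : P.NotRead M.rret) (hW : Consistent M P C W)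
    {sp v a : LVal V L} (hi : C.buf.get W.first = some .call)
    (hsp : C.buf.get (W.first + 1) = some (.value M.rsp sp))
    (hst : C.buf.get (W.first + 2) = some (.store (.val v) (.inr a))) :
    StepSimulated M P W C .retire [.write a]
      { C with
        reg := Function.update C.reg M.rsp (some sp)
        mem := Function.update C.mem a.val (some v)
        buf := C.buf.above (W.first + 2) } := by
  refine hW.stepSimulated_of_commits hP (hi ▸ Option.some_ne_none _) (len := 3)
    ⟨rfl, fun k => FMap.get_above _ _ _,
      fun r _ => congrFun (hW.resolveReg_of_call hi hsp hst).2.2.symm r,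
      fun j hj src dst hs => ?_, fun b hb => ⟨W.first + 2, by omega, _, a, hst, ?_⟩⟩
    (fun ts q => hW.archStep_call hi hsp hst) ?_
  · obtain hj | rfl | rfl | rfl :
      j < W.first ∨ j = W.first ∨ j = W.first + 1 ∨ j = W.first + 2 := by omega
    · cases (hW.get_eq_none_of_lt hj).symm.trans hs
    · cases hi.symm.trans hs
    · cases hsp.symm.trans hs
    · cases hst.symm.trans hs
      exact ⟨v, a, rfl, rfl, Function.update_self _ _ _⟩
  · by_contra hne
    exact hb (Function.update_of_ne (Ne.symm hne) _ _)
  · rw [hW.headLabels_of_call hi hsp hst, obsLabels_write]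

theorem archStep_ret (hW : Consistent M P C W) {t₁ t₂ : Transient R V L Op} {w sp : LVal V L}
    {n q : V} {ts : List (Transient R V L Op)} (hi : C.buf.get W.first = some .ret)
    (h₁ : C.buf.get (W.first + 1) = some t₁) (ht₁ : t₁.IsValue M.rret w)
    (h₂ : C.buf.get (W.first + 2) = some t₂) (ht₂ : t₂.IsValue M.rsp sp)
    (h₃ : C.buf.get (W.first + 3) = some (.jump n)) (hts : Fetched M P W.pc ts q)
    (hlists : ListsFrom W.orig W.first ts) :
    ts.length = 4 ∧ ArchStep M P ⟨C.reg, C.mem, W.pc⟩ (W.headLabels 4)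
      ⟨Function.update C.reg M.rsp (some sp), C.mem, q⟩ := by
  obtain ⟨hreg₁, hreg₂, hreg₃⟩ := hW.resolveReg_of_ret hi h₁ ht₁ h₂ ht₂
  obtain ⟨_, _, horig, hT₀, -, -, href⟩ := hW.exists_refines hi
  obtain ⟨_, _, horig₁, hT₁, -, -, href₁⟩ := hW.exists_refines h₁
  obtain ⟨_, _, horig₂, hT₂, -, -, href₂⟩ := hW.exists_refines h₂
  obtain ⟨_, _, horig₃, hT₃, -, -, href₃⟩ := hW.exists_refines h₃
  cases href
  obtain ⟨hPC, rfl⟩ := hts.eq_ret (by rw [hlists 0 hts.length_pos, Nat.add_zero, horig])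
  cases (hlists 1 (by simp)).trans (congrArg some horig₁)
  cases (hlists 2 (by simp)).trans (congrArg some horig₂)
  cases (hlists 3 (by simp)).trans (congrArg some horig₃)
  obtain ⟨a, dep, ha, hl, rfl⟩ := href₁.of_load ht₁
  obtain ⟨hsp, rfl⟩ := href₂.of_op ht₂
  cases href₃ with | @jmpiJump _ n hn =>
  rw [hreg₁] at ha
  rw [hreg₂] at hsp
  rw [hreg₃] at hn
  have hw : C.mem a.val = some w := by
    refine hl.mem_eq fun j hj src dst hs => ?_
    obtain hj | rfl := Nat.lt_succ_iff_lt_or_eq.1 hj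
    · cases (hW.get_eq_none_of_lt hj).symm.trans hs
    · cases hi.symm.trans hs
  have hlabels : W.headLabels 4 = {a.lab, n.lab} := by
    simp only [W.headLabels_succ, W.headLabels_zero, Nat.add_zero, hT₀, hT₁, hT₂, hT₃,
      Set.empty_union, Set.union_empty, Set.singleton_union]
  refine ⟨rfl, hlabels ▸ ⟨_, hPC, .ret ha hw (hsp.mono ?_) ((EvalTo.reg_iff_val ?_).1 hn)⟩⟩
  · rintro r hr v hv
    obtain rfl : r = M.rsp := by simpa using hr
    rwa [Function.update_of_ne M.rret_ne_rsp.symm] at hv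
  · rw [Function.update_of_ne M.rret_ne_rsp, Function.update_self]

theorem stepSimulated_ret_retire (hP : P.NotRead M.rret) (hW : Consistent M P C W)
    {t₁ t₂ : Transient R V L Op} {w sp : LVal V L} {n : V}
    (hi : C.buf.get W.first = some .ret) (h₁ : C.buf.get (W.first + 1) = some t₁)
    (ht₁ : t₁.IsValue M.rret w) (h₂ : C.buf.get (W.first + 2) = some t₂)
    (ht₂ : t₂.IsValue M.rsp sp) (h₃ : C.buf.get (W.first + 3) = some (.jump n)) :
    StepSimulated M P W C .retire []
      { C with
        reg := Function.update C.reg M.rsp (some sp)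
        buf := C.buf.above (W.first + 3) } := by
  refine hW.stepSimulated_of_commits hP (hi ▸ Option.some_ne_none _) (len := 4)
    ⟨rfl, fun k => FMap.get_above _ _ _, fun r hr => ?_, fun j hj src dst hs => ?_,
      fun b hb => absurd rfl hb⟩
    (fun ts q => hW.archStep_ret hi h₁ ht₁ h₂ ht₂ h₃) (by simp)
  · rw [Config.resolveReg_succ_of_get h₃, (hW.resolveReg_of_ret hi h₁ ht₁ h₂ ht₂).2.2,
      Transient.assign_of_target_eq_none _ rfl, Function.update_comm M.rret_ne_rsp,
      Function.update_of_ne hr]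
  · obtain hj | rfl | rfl | rfl | rfl : j < W.first ∨ j = W.first ∨ j = W.first + 1 ∨
      j = W.first + 2 ∨ j = W.first + 3 := by omega
    · cases (hW.get_eq_none_of_lt hj).symm.trans hs
    · cases hi.symm.trans hs
    · cases h₁.symm.trans hs
      cases ht₁
    · cases h₂.symm.trans hs
      cases ht₂
    · cases h₃.symm.trans hs

theorem stepSimulated_retire (hP : P.NotRead M.rret) (hW : Consistent M P C W)
    (h : Step M P C .retire O C') : StepSimulated M P W C .retire O C' := by
  cases h with
  | value_retire i t r v hmin hi ht =>
    obtain rfl := hW.eq_first_of_retirable hmin hi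
    exact hW.stepSimulated_value_retire hP hi ht
  | jump_retire i n hmin hi =>
    obtain rfl := hW.eq_first_of_retirable hmin hi
    exact hW.stepSimulated_jump_retire hP hi
  | fence_retire i hmin hi =>
    obtain rfl := hW.eq_first_of_retirable hmin hi
    exact hW.stepSimulated_fence_retire hP hi
  | store_retire i v a hmin hi =>
    obtain rfl := hW.eq_first_of_retirable hmin hi
    exact hW.stepSimulated_store_retire hP hi
  | call_retire i sp v a hmin hi hsp hst =>
    obtain rfl := hW.eq_first_of_retirable hmin hi
    exact hW.stepSimulated_call_retire hP hi hsp hst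
  | ret_retire i t₁ t₂ w sp n hmin hi h₁ ht₁ h₂ ht₂ h₃ =>
    obtain rfl := hW.eq_first_of_retirable hmin hi
    exact hW.stepSimulated_ret_retire hP hi h₁ ht₁ h₂ ht₂ h₃

theorem stepSimulated (hP : P.NotRead M.rret) (hW : Consistent M P C W)
    (h : Step M P C d O C') : StepSimulated M P W C d O C' := by
  cases d with
  | exec => exact hW.stepSimulated_exec h
  | execFwd => cases h with
    | load_execute_guess _ _ _ _ _ _ _ hi _ hji hj => exact hW.stepSimulated_guess hi hji hj
  | execValue => cases h with
    | store_execute_value _ _ _ _ hi _ hv => exact hW.stepSimulated_storeValue hi hv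
  | execAddr => cases h with
    | store_execute_addr_ok _ _ _ _ hi _ ha hk => exact hW.stepSimulated_storeAddr_ok hi ha hk
    | store_execute_addr_hazard _ _ _ _ _ _ _ _ _ _ hi _ ha hk hload =>
      exact hW.stepSimulated_storeAddr_hazard hi ha hk hload
  | retire => exact hW.stepSimulated_retire hP h
  | _ => exact hW.stepSimulated_fetch h rfl

end Consistent

end StepRetire

/-! ### Executions -/

theorem Config.Idle.get_eq_none {C : Config R V L Op} (hC : C.Idle) (k : ℕ) :
    C.buf.get k = none :=
  congrArg (FMap.get · k) hC

theorem Config.Idle.noGuess {C : Config R V L Op} (hC : C.Idle) : C.NoGuess :=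
  fun k _ _ _ _ _ hk => nomatch (hC.get_eq_none k).symm.trans hk

/-- The ghost state of an idle configuration at program point `n`. -/
def Window.empty (n : V) : Window R V L Op where
  orig _ := .fence
  lab _ := ∅
  first := 1
  limit := 1
  count := 0
  pc := n

theorem Config.Idle.consistent [Lattice L] [OrderBot L] {M : Machine R V Op}
    {P : Program R V L Op} {C : Config R V L Op} (hC : C.Idle) :
    Consistent M P C (.empty C.pc) where
  chain := .nil _ _
  entry _ hk hk' := absurd hk hk'.not_ge
  outside k hk := absurd (hC.get_eq_none k) hk

theorem Consistent.labels_eq_empty [Lattice L] [OrderBot L] {M : Machine R V Op}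
    {P : Program R V L Op} {C : Config R V L Op} {W : Window R V L Op} (hW : Consistent M P C W)
    (hC : C.Idle) : W.labels = ∅ :=
  Window.labels_eq_empty (hW.idle_iff.1 hC ▸ hW.chain).eq_of_count_eq_zero.1.ge

section Executions

variable [DecidableEq R] [DecidableEq V] [Lattice L] [OrderBot L] {M : Machine R V Op}
  {P : Program R V L Op} {C C' C'' : Config R V L Op} {W : Window R V L Op}
  {D D' : List (Directive V)} {d : Directive V} {O O' : List (Obs V L)}

theorem Simulates.nil (hW : Consistent M P C W) : Simulates M P C W [] [] C W ∅ where
  consistent := hW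
  archRun := .nil _
  labels_subset := by rw [Set.empty_union, obsLabels_nil, Set.union_empty]
  count_le := le_rfl

theorem Exec.append (h : Exec M P C D O C') (h' : Exec M P C' D' O' C'') :
    Exec M P C (D ++ D') (O ++ O') C'' := by
  induction h with
  | nil => exact h'
  | cons hstep _ ih =>
    rw [List.append_assoc]
    exact .cons hstep (ih h')

theorem Exec.simulates (hP : P.NotRead M.rret) (h : Exec M P C D O C')
    (hW : Consistent M P C W) : ∃ W' A, Simulates M P C W D O C' W' A := by
  induction h generalizing W with
  | nil => exact ⟨W, ∅, .nil hW⟩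
  | cons hstep _ ih =>
    obtain ⟨W₁, A, hsim, -⟩ := hW.stepSimulated hP hstep
    obtain ⟨W₂, A', hsim'⟩ := ih hsim.consistent
    exact ⟨W₂, A ∪ A', hsim.trans hsim'⟩

theorem IsSequential.tail (h : IsSequential M P C (d :: D)) (hstep : Step M P C d O C') :
    IsSequential M P C' D :=
  fun D₁ D₂ d' _ C'' hD hd' hexec => h (d :: D₁) D₂ d' _ C'' (hD ▸ rfl) hd' (.cons hstep hexec)

theorem IsSequential.exists_simulates (hP : P.NotRead M.rret) (hseq : IsSequential M P C D)
    (h : Exec M P C D O C') (hW : Consistent M P C W) (hguess : C.NoGuess) (hone : W.count ≤ 1) :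
    ∃ W' A, Simulates M P C W D O C' W' A ∧ W.labels ∪ obsLabels O ⊆ A ∪ W'.labels := by
  induction h generalizing W with
  | nil => exact ⟨W, ∅, .nil hW, by rw [Set.empty_union, obsLabels_nil, Set.union_empty]⟩
  | @cons C C₁ C₂ d D O O' hstep _ ih =>
    have hfetch (hd : d.isFetch) : W.count = 0 :=
      hW.idle_iff.1 (hseq [] D d [] C rfl hd (.nil C))
    obtain ⟨W₁, A, hsim, hexact⟩ := hW.stepSimulated hP hstep
    obtain ⟨hguess₁, hlabels⟩ := hexact hguess hone hfetch
    have hone₁ : W₁.count ≤ 1 := by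
      have hcount := hsim.count_le
      rw [List.countP_singleton] at hcount
      split_ifs at hcount with hd
      · have := hfetch hd
        omega
      · omega
    obtain ⟨W₂, A', hsim', hlabels'⟩ := ih (hseq.tail hstep) hsim.consistent hguess₁ hone₁
    refine ⟨W₂, A ∪ A', hsim.trans hsim', ?_⟩
    calc W.labels ∪ obsLabels (O ++ O') ⊆ A ∪ (W₁.labels ∪ obsLabels O') := by
          rw [obsLabels_append, ← Set.union_assoc, ← Set.union_assoc]
          exact Set.union_subset_union_left _ hlabels
      _ ⊆ A ∪ A' ∪ W₂.labels := by
          rw [Set.union_assoc]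
          exact Set.union_subset_union_right _ hlabels'

theorem SeqExec.obsLabels_subset {C₁ C₂ : Config R V L Op} {D₁ D₂ : List (Directive V)}
    {O₁ O₂ : List (Obs V L)} (hP : P.NotRead M.rret) (h₂ : SeqExec M P C D₂ O₂ C₂)
    (h₁ : Exec M P C D₁ O₁ C₁) (hn : numRetired D₂ ≤ numRetired D₁) :
    obsLabels O₂ ⊆ obsLabels O₁ := by
  obtain ⟨hC, hseq, hexec, hC₂⟩ := h₂
  obtain ⟨W₁, A₁, hsim₁⟩ := h₁.simulates hP hC.consistent
  obtain ⟨W₂, A₂, hsim₂, hexact⟩ :=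
    hseq.exists_simulates hP hexec hC.consistent hC.noGuess (Nat.zero_le 1)
  have hstart : (Window.empty C.pc : Window R V L Op).labels = ∅ :=
    Window.labels_eq_empty le_rfl
  have hfinish : W₂.labels = ∅ := hsim₂.consistent.labels_eq_empty hC₂
  rw [hstart, hfinish, Set.empty_union, Set.union_empty] at hexact
  calc obsLabels O₂ ⊆ A₂ := hexact
    _ ⊆ A₁ := hsim₂.archRun.labels_subset hsim₁.archRun hn
    _ ⊆ A₁ ∪ W₁.labels := Set.subset_union_left
    _ ⊆ obsLabels O₁ := by simpa only [hstart, Set.empty_union] using hsim₁.labels_subset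

end Executions

/-! ### Realizing runs of the in-order machine -/

namespace Config

/-- The registers and the memory of `C` are `f` and `μ`, and its buffer consists of the entries
`ts`, starting at index `1`, the first index used by a configuration with an empty buffer. -/
structure Holds (C : Config R V L Op) (f : R → Option (LVal V L)) (μ : V → Option (LVal V L))
    (ts : List (Transient R V L Op)) : Prop where
  reg : C.reg = f
  mem : C.mem = μ
  get_zero : C.buf.get 0 = none
  get_succ : ∀ k, C.buf.get (k + 1) = ts[k]?

namespace Holds

variable {C C' : Config R V L Op} {f : R → Option (LVal V L)} {μ : V → Option (LVal V L)}
  {ts : List (Transient R V L Op)} {t t' : Transient R V L Op} {i limit : ℕ}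

theorem of_appends (hC : C.Idle) (h : C.Appends ts C') : C'.Holds C.reg C.mem ts := by
  have hfresh : C.fresh = 1 := by rw [Config.fresh, hC, FMap.maxIdx_empty]
  refine ⟨h.reg, h.mem, ?_, fun k => ?_⟩
  · rw [h.get, hfresh, if_pos zero_lt_one, hC.get_eq_none]
  · rw [h.get, hfresh, if_neg (by omega), Nat.add_sub_cancel]

theorem mem_of_get (h : C.Holds f μ ts) {k : ℕ} (hk : C.buf.get k = some t) :
    t ∈ ts := by
  cases k with
  | zero => cases h.get_zero.symm.trans hk
  | succ k => exact List.mem_of_getElem? ((h.get_succ k).symm.trans hk)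

theorem replaced (h : C.Holds f μ ts) (hC : C.Replaced (i + 1) limit t t' C')
    (hlimit : ts.length < limit) : C'.Holds f μ (ts.set i t') where
  reg := hC.reg.trans h.reg
  mem := hC.mem.trans h.mem
  get_zero := by rw [hC.get, if_neg i.succ_ne_zero.symm, h.get_zero, ite_self]
  get_succ k := by
    have hi : i < ts.length := by
      by_contra hi
      cases hC.old.symm.trans ((h.get_succ i).trans (List.getElem?_eq_none (not_lt.1 hi)))
    rw [hC.get, h.get_succ]
    grind

theorem setBuf (h : C.Holds f μ ts) (hi : ts[i]? = some t) :
    (C.setBuf (i + 1) t').Holds f μ (ts.set i t') := by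
  refine h.replaced (.setBuf ((h.get_succ i).trans hi) ?_ fun k hk => ?_) ts.length.lt_succ_self
  · exact Nat.succ_lt_succ (List.getElem?_eq_some_iff.1 hi).1
  · obtain ⟨k, rfl⟩ := Nat.exists_eq_succ_of_ne_zero (Nat.ne_zero_of_lt hk)
    exact (h.get_succ k).trans (List.getElem?_eq_none (Nat.succ_le_succ_iff.1 hk))

theorem redirect (h : C.Holds f μ ts) (hi : ts[i]? = some t) (hlast : ts.length = i + 1)
    (n : V) : ((C.rollback (i + 1) n).setBuf (i + 1) t').Holds f μ (ts.set i t') :=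
  h.replaced (.rollback_self ((h.get_succ i).trans hi) n) (by omega)

theorem noFence (h : C.Holds f μ ts) (hf : .fence ∉ ts) : C.NoFence i :=
  fun _ _ hj => hf (h.mem_of_get hj)

theorem retirable (h : C.Holds f μ ts) (hi : ts[0]? = some t) : C.Retirable 1 := by
  refine FMap.minIdx_eq (by simp [h.get_succ 0, hi]) fun k hk => Nat.one_le_iff_ne_zero.2 ?_
  rintro rfl
  exact hk h.get_zero

theorem erase_eq_empty (h : C.Holds f μ [t]) : C.buf.erase 1 = FMap.empty := by
  refine FMap.ext_get fun k => ?_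
  rw [FMap.get_erase]
  rcases k with _ | _ | k
  · exact h.get_zero
  · rfl
  · exact h.get_succ (k + 1)

theorem above_eq_empty (h : C.Holds f μ ts) (hi : ts.length ≤ i) : C.buf.above i = FMap.empty := by
  refine FMap.ext_get fun k => ?_
  rw [FMap.get_above]
  split_ifs with hk
  · obtain ⟨k, rfl⟩ := Nat.exists_eq_succ_of_ne_zero (Nat.ne_zero_of_lt hk)
    exact (h.get_succ k).trans (List.getElem?_eq_none (by omega))
  · rfl

theorem resolveReg_eq (h : C.Holds f μ ts) (i : ℕ) :
    C.resolveReg (i + 1) = (ts.take i).foldl Transient.assign f := by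
  induction i with
  | zero =>
    rw [resolveReg_succ, h.get_zero, Option.elim_none, resolveReg_zero, h.reg]
    rfl
  | succ i ih =>
    rw [resolveReg_succ, h.get_succ, ih, List.take_add_one, List.foldl_append]
    cases ts[i]? <;> rfl

theorem exists_resolves [Lattice L] [OrderBot L] (h : C.Holds f μ ts) {F : List V → Option V}
    {args : List (Operand R V L)} {v : LVal V L}
    (hv : EvalTo F ((ts.take i).foldl Transient.assign f) args v) :
    ∃ vs, C.Resolves (i + 1) args vs ∧ F (vs.map LVal.val) = some v.val ∧ v.lab = joinLab vs := by
  simpa only [resolves_iff, h.resolveReg_eq, EvalTo] using hv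

theorem resolvesAddr [Lattice L] [OrderBot L] (h : C.Holds f μ ts) {M : Machine R V Op}
    {args : List (Operand R V L)} {a : LVal V L}
    (ha : EvalTo M.addr ((ts.take i).foldl Transient.assign f) args a) :
    C.ResolvesAddr M (i + 1) args a :=
  h.exists_resolves ha

end Holds

end Config

section Realization

variable [DecidableEq R] [DecidableEq V] [Lattice L] [OrderBot L] {M : Machine R V Op}
  {P : Program R V L Op} {f : R → Option (LVal V L)} {μ : V → Option (LVal V L)}
  {ts ts' : List (Transient R V L Op)} {t : Transient R V L Op} {i : ℕ}

/-- A configuration whose buffer consists of the entries `ts` of a single instruction can execute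
and retire it without fetching. -/
def Completes (M : Machine R V Op) (P : Program R V L Op) (f : R → Option (LVal V L))
    (μ : V → Option (LVal V L)) (ts : List (Transient R V L Op)) : Prop :=
  ∀ C : Config R V L Op, C.Holds f μ ts → ∃ D O C', Exec M P C D O C' ∧ C'.Idle ∧
    numRetired D = 1 ∧ D.countP Directive.isFetch = 0

namespace Completes

theorem of_exec (h : Completes M P f μ ts')
    (hstep : ∀ C : Config R V L Op, C.Holds f μ ts → ∃ d O C', Step M P C d O C' ∧
      d.isFetch = false ∧ d.isRetire = false ∧ C'.Holds f μ ts') : Completes M P f μ ts := by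
  intro C hC
  obtain ⟨d, O, C₁, hd, hfetch, hretire, hC₁⟩ := hstep C hC
  obtain ⟨D, O', C₂, hD, hidle, hnum, hcount⟩ := h C₁ hC₁
  refine ⟨d :: D, O ++ O', C₂, .cons hd hD, hidle, ?_, ?_⟩
  · rwa [numRetired, List.countP_cons_of_neg (by simp [hretire])]
  · rwa [List.countP_cons_of_neg (by simp [hfetch])]

theorem of_retire (hstep : ∀ C : Config R V L Op, C.Holds f μ ts →
    ∃ O C', Step M P C .retire O C' ∧ C'.Idle) : Completes M P f μ ts := by
  intro C hC
  obtain ⟨O, C', hstep, hidle⟩ := hstep C hC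
  exact ⟨[.retire], _, C', .cons hstep (.nil C'), hidle, rfl, rfl⟩

theorem op {r : R} {o : Op} {args : List (Operand R V L)} {v : LVal V L}
    (hi : ts[i]? = some (.op r o args)) (hf : .fence ∉ ts)
    (hv : EvalTo (M.evalOp o) ((ts.take i).foldl Transient.assign f) args v)
    (h : Completes M P f μ (ts.set i (.value r v))) : Completes M P f μ ts :=
  h.of_exec fun C hC => by
    obtain ⟨vs, hvs, hv, hlab⟩ := hC.exists_resolves hv
    obtain ⟨v, l⟩ := v
    obtain rfl : l = joinLab vs := hlab
    exact ⟨_, _, _, .op_execute (i + 1) r o args vs v ((hC.get_succ i).trans hi) (hC.noFence hf)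
      hvs hv, rfl, rfl, hC.setBuf hi⟩

theorem br {o : Op} {args : List (Operand R V L)} {g nT nF : V} {n : LVal V L}
    (hi : ts[i]? = some (.br o args g nT nF)) (hlast : ts.length = i + 1) (hf : .fence ∉ ts)
    (hn : EvalTo (M.branchTarget o nT nF) ((ts.take i).foldl Transient.assign f) args n)
    (h : Completes M P f μ (ts.set i (.jump n.val))) : Completes M P f μ ts :=
  h.of_exec fun C hC => by
    obtain ⟨vs, hvs, hn, -⟩ := hC.exists_resolves hn
    obtain ⟨b, hb, hbn⟩ := Option.map_eq_some_iff.1 hn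
    have hget := (hC.get_succ i).trans hi
    by_cases hg : n.val = g
    · subst hg
      exact ⟨_, _, _, .br_execute_correct (i + 1) o args _ nT nF vs b hget (hC.noFence hf) hvs hb
        hbn, rfl, rfl, hC.setBuf hi⟩
    · exact ⟨_, _, _, .br_execute_incorrect (i + 1) o args g nT nF vs b n.val hget
        (hC.noFence hf) hvs hb hbn hg, rfl, rfl, hC.redirect hi hlast _⟩

theorem jmpi {args : List (Operand R V L)} {g : V} {n : LVal V L}
    (hi : ts[i]? = some (.jmpi args g)) (hlast : ts.length = i + 1) (hf : .fence ∉ ts)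
    (hn : EvalTo M.addr ((ts.take i).foldl Transient.assign f) args n)
    (h : Completes M P f μ (ts.set i (.jump n.val))) : Completes M P f μ ts :=
  h.of_exec fun C hC => by
    have hget := (hC.get_succ i).trans hi
    by_cases hg : n.val = g
    · subst hg
      exact ⟨_, _, _, .jmpi_execute_correct (i + 1) args _ n hget (hC.noFence hf)
        (hC.resolvesAddr hn) rfl, rfl, rfl, hC.setBuf hi⟩
    · exact ⟨_, _, _, .jmpi_execute_incorrect (i + 1) args g n hget (hC.noFence hf)
        (hC.resolvesAddr hn) hg, rfl, rfl, hC.redirect hi hlast _⟩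

theorem load {r : R} {args : List (Operand R V L)} {pt : V} {a v : LVal V L}
    (hi : ts[i]? = some (.load r args pt)) (hf : .fence ∉ ts)
    (hs : ∀ src dst, .store src dst ∉ ts)
    (ha : EvalTo M.addr ((ts.take i).foldl Transient.assign f) args a) (hv : μ a.val = some v)
    (h : Completes M P f μ (ts.set i (.loaded r v ⊥ a.val pt))) : Completes M P f μ ts :=
  h.of_exec fun _ hC => ⟨_, _, _, .load_execute_nodep (i + 1) r args pt a v
    ((hC.get_succ i).trans hi) (hC.noFence hf) (hC.resolvesAddr ha)
    (fun _ _ ⟨_, _, hj, _⟩ => hs _ _ (hC.mem_of_get hj)) (hC.mem ▸ hv), rfl, rfl, hC.setBuf hi⟩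

theorem storeValue {src : Operand R V L} {dst : List (Operand R V L) ⊕ LVal V L} {v : LVal V L}
    (hi : ts[i]? = some (.store src dst)) (hf : .fence ∉ ts)
    (hv : evalOperand ((ts.take i).foldl Transient.assign f) src = some v)
    (h : Completes M P f μ (ts.set i (.store (.val v) dst))) : Completes M P f μ ts :=
  h.of_exec fun _ hC => ⟨_, _, _, .store_execute_value (i + 1) src dst v
    ((hC.get_succ i).trans hi) (hC.noFence hf)
    (by rw [Config.resolve_eq, hC.resolveReg_eq, hv]), rfl, rfl, hC.setBuf hi⟩

theorem storeAddr {src : Operand R V L} {args : List (Operand R V L)} {a : LVal V L}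
    (hi : ts[i]? = some (.store src (.inl args))) (hf : .fence ∉ ts)
    (hl : ∀ r v dep b pt, .loaded r v dep b pt ∉ ts)
    (ha : EvalTo M.addr ((ts.take i).foldl Transient.assign f) args a)
    (h : Completes M P f μ (ts.set i (.store src (.inr a)))) : Completes M P f μ ts :=
  h.of_exec fun _ hC => ⟨_, _, _, .store_execute_addr_ok (i + 1) src args a
    ((hC.get_succ i).trans hi) (hC.noFence hf) (hC.resolvesAddr ha)
    (fun _ ⟨_, _, _, _, _, _, hk, _⟩ => hl _ _ _ _ _ (hC.mem_of_get hk)), rfl, rfl,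
    hC.setBuf hi⟩

theorem value_retire {r : R} {v : LVal V L} (ht : t.IsValue r v) : Completes M P f μ [t] :=
  of_retire fun _ hC =>
    ⟨_, _, .value_retire 1 t r v (hC.retirable rfl) (hC.get_succ 0) ht, hC.erase_eq_empty⟩

theorem jump_retire (n : V) : Completes M P f μ [.jump n] :=
  of_retire fun _ hC =>
    ⟨_, _, .jump_retire 1 n (hC.retirable rfl) (hC.get_succ 0), hC.erase_eq_empty⟩

theorem fence_retire : Completes M P f μ [.fence] :=
  of_retire fun _ hC =>
    ⟨_, _, .fence_retire 1 (hC.retirable rfl) (hC.get_succ 0), hC.erase_eq_empty⟩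

theorem store_retire (v a : LVal V L) : Completes M P f μ [.store (.val v) (.inr a)] :=
  of_retire fun _ hC =>
    ⟨_, _, .store_retire 1 v a (hC.retirable rfl) (hC.get_succ 0), hC.erase_eq_empty⟩

theorem call_retire (sp v a : LVal V L) :
    Completes M P f μ [.call, .value M.rsp sp, .store (.val v) (.inr a)] :=
  of_retire fun _ hC =>
    ⟨_, _, .call_retire 1 sp v a (hC.retirable rfl) (hC.get_succ 0) (hC.get_succ 1)
      (hC.get_succ 2), hC.above_eq_empty le_rfl⟩

theorem ret_retire (w sp : LVal V L) (dep : WithBot ℕ) (a pt n : V) :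
    Completes M P f μ [.ret, .loaded M.rret w dep a pt, .value M.rsp sp, .jump n] :=
  of_retire fun _ hC =>
    ⟨_, _, .ret_retire 1 _ _ w sp n (hC.retirable rfl) (hC.get_succ 0) (hC.get_succ 1)
      (.loaded _ _ _ _ _) (hC.get_succ 2) (.value _ _) (hC.get_succ 3), hC.above_eq_empty le_rfl⟩

theorem call {nret : V} {sp a : LVal V L} (hsp : EvalTo (M.evalOp M.succ) f [.reg M.rsp] sp)
    (ha : EvalTo M.addr f [.val sp] a) : Completes M P f μ [.call,
      .op M.rsp M.succ [.reg M.rsp], .store (.val ⟨nret, ⊥⟩) (.inl [.reg M.rsp])] := by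
  refine .op (i := 1) rfl (by simp) (v := sp) ?_
    (.storeAddr (i := 2) rfl (by simp) (by simp) (a := a) ?_ (.call_retire _ _ _))
  · rwa [List.take_succ_cons, List.take_zero, List.foldl_cons,
      Transient.assign_of_target_eq_none f rfl]
  · refine (EvalTo.reg_iff_val ?_).2 ha
    simp [Transient.assign, Transient.target, Transient.result]

theorem ret {pt g : V} {a w sp n : LVal V L} (ha : EvalTo M.addr f [.reg M.rsp] a)
    (hw : μ a.val = some w) (hsp : EvalTo (M.evalOp M.pred) f [.reg M.rsp] sp)
    (hn : EvalTo M.addr f [.val w] n) : Completes M P f μ [.ret, .load M.rret [.reg M.rsp] pt,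
      .op M.rsp M.pred [.reg M.rsp], .jmpi [.reg M.rret] g] := by
  refine .load (i := 1) rfl (by simp) (by simp) (a := a) ?_ hw
    (.op (i := 2) rfl (by simp) (v := sp) ?_
      (.jmpi (i := 3) rfl rfl (by simp) (n := n) ?_ (.ret_retire _ _ _ _ _ _)))
  · rwa [List.take_succ_cons, List.take_zero, List.foldl_cons,
      Transient.assign_of_target_eq_none f rfl]
  · refine hsp.mono fun r hr v hv => ?_
    obtain rfl : r = M.rsp := by simpa using hr
    simpa [Transient.assign, Transient.target, M.rret_ne_rsp] using hv
  · refine (EvalTo.reg_iff_val ?_).2 hn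
    simp [Transient.assign, Transient.target, Transient.result, M.rret_ne_rsp.symm]

end Completes

theorem ArchEffect.completes {s s' : ArchState R V L} {ins : Instr R V L Op} {T : Set L} {m : V}
    (h : ArchEffect M s ins T s') (hP : P s.pc = some ins) (hts : Fetched M P s.pc ts m) :
    Completes M P s.reg s.mem ts := by
  cases hts with
  | op hP' =>
    cases hP.symm.trans hP'
    cases h with | op hv =>
    exact .op (i := 0) rfl (by simp) hv (.value_retire (.value _ _))
  | br _ hP' =>
    cases hP.symm.trans hP'
    cases h with | br hn =>
    exact .br (i := 0) rfl rfl (by simp) hn (.jump_retire _)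
  | load hP' =>
    cases hP.symm.trans hP'
    cases h with | load ha hv =>
    exact .load (i := 0) rfl (by simp) (by simp) ha hv (.value_retire (.loaded _ _ _ _ _))
  | store hP' =>
    cases hP.symm.trans hP'
    cases h with | store ha hv =>
    exact .storeValue (i := 0) rfl (by simp) hv
      (.storeAddr (i := 0) rfl (by simp) (by simp) ha (.store_retire _ _))
  | jmpi _ hP' =>
    cases hP.symm.trans hP'
    cases h with | jmpi hn =>
    exact .jmpi (i := 0) rfl rfl (by simp) hn (.jump_retire _)
  | call hP' =>
    cases hP.symm.trans hP'
    cases h with | call hsp ha =>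
    exact .call hsp ha
  | ret _ hP' =>
    cases hP.symm.trans hP'
    cases h with | ret ha hw hsp hn =>
    exact .ret ha hw hsp hn
  | fence hP' => exact .fence_retire

end Realization

/-! ### In-order schedules -/

/-- In-order schedules: every fetch is preceded by as many retire directives as fetches, which for
an execution from an idle configuration means that the buffer is empty at each fetch. -/
def InOrder (D : List (Directive V)) : Prop :=
  ∀ (D₁ D₂ : List (Directive V)) (d : Directive V), D = D₁ ++ d :: D₂ → d.isFetch →
    D₁.countP Directive.isFetch = numRetired D₁

section InOrder

variable {D D' : List (Directive V)}

theorem InOrder.nil : InOrder ([] : List (Directive V)) :=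
  fun _ _ _ h => absurd h.symm (by simp)

theorem InOrder.cons_of_countP_eq_zero (d : Directive V)
    (hD : D.countP Directive.isFetch = 0) : InOrder (d :: D) := by
  intro D₁ D₂ d' hsplit hd'
  rcases D₁ with _ | ⟨d₁, D₁⟩
  · rfl
  · obtain ⟨-, rfl⟩ := List.cons.inj hsplit
    exact absurd hd' (List.countP_eq_zero.1 hD d' (by simp))

theorem InOrder.append (hD : InOrder D) (hD' : InOrder D')
    (hcount : D.countP Directive.isFetch = numRetired D) : InOrder (D ++ D') := by
  intro D₁ D₂ d hsplit hd
  rcases List.append_eq_append_iff.1 hsplit with ⟨E, rfl, hE⟩ | ⟨E, rfl, hE⟩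
  · rw [numRetired, List.countP_append, List.countP_append, hcount, hD' E D₂ d hE hd]
    rfl
  · rcases E with _ | ⟨e, E⟩
    · simpa using hcount
    · obtain ⟨rfl, -⟩ := List.cons.inj hE
      exact hD D₁ E d rfl hd

end InOrder

section Sequential

variable [DecidableEq R] [DecidableEq V] [Lattice L] [OrderBot L] {M : Machine R V Op}
  {P : Program R V L Op} {C C' : Config R V L Op} {D D' : List (Directive V)} {d : Directive V}
  {O : List (Obs V L)} {s s' : ArchState R V L} {T A : Set L} {n : ℕ}

theorem Exec.archRun (hP : P.NotRead M.rret) (hC : C.Idle) (hC' : C'.Idle)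
    (h : Exec M P C D O C') :
    ∃ A, ArchRun M P ⟨C.reg, C.mem, C.pc⟩ (numRetired D) A ⟨C'.reg, C'.mem, C'.pc⟩ := by
  obtain ⟨W, A, hsim⟩ := h.simulates hP hC.consistent
  have hchain := hsim.consistent.chain
  rw [hsim.consistent.idle_iff.1 hC'] at hchain
  exact ⟨A, hchain.eq_of_count_eq_zero.2 ▸ hsim.archRun⟩

theorem Step.exists_fetch {ins : Instr R V L Op} (hP : P C.pc = some ins) :
    ∃ d C', Step M P C d [] C' ∧ d.isFetch := by
  cases ins with
  | op o r args next => exact ⟨_, _, .op_fetch o r args next hP, rfl⟩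
  | br o args nT nF => exact ⟨_, _, .br_fetch true o args nT nF hP, rfl⟩
  | load r args next => exact ⟨_, _, .load_fetch r args next hP, rfl⟩
  | store src args next => exact ⟨_, _, .store_fetch src args next hP, rfl⟩
  | jmpi args => exact ⟨_, _, .jmpi_fetch C.pc args hP, rfl⟩
  | call nf nret => exact ⟨_, _, .call_fetch nf nret hP, rfl⟩
  | ret =>
    cases htop : rsbTop C.rsb with
    | none => exact ⟨_, _, .ret_fetch_rsb_empty C.pc hP htop, rfl⟩
    | some n => exact ⟨_, _, .ret_fetch_rsb n hP htop, rfl⟩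
  | fence next => exact ⟨_, _, .fence_fetch next hP, rfl⟩

theorem ArchStep.exists_exec (hC : C.Idle) (h : ArchStep M P ⟨C.reg, C.mem, C.pc⟩ T s) :
    ∃ D O C', Exec M P C D O C' ∧ C'.Idle ∧ InOrder D ∧ numRetired D = 1 ∧
      D.countP Directive.isFetch = 1 := by
  obtain ⟨ins, hins, heff⟩ := h
  obtain ⟨d, C₁, hfetch, hd⟩ := Step.exists_fetch hins
  obtain ⟨ts, hts, happ, -⟩ := hfetch.exists_fetched hd
  obtain ⟨D, O, C', hexec, hC', hretired, hcount⟩ :=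
    heff.completes hins hts C₁ (.of_appends hC happ)
  have hd' : d.isRetire = false := by cases d <;> first | rfl | cases hd
  refine ⟨d :: D, _, C', .cons hfetch hexec, hC', .cons_of_countP_eq_zero d hcount, ?_, ?_⟩
  · rwa [numRetired, List.countP_cons_of_neg (by simp [hd'])]
  · rw [List.countP_cons_of_pos hd, hcount]

theorem ArchRun.exists_exec (hP : P.NotRead M.rret) (hC : C.Idle) (h : ArchRun M P s n A s')
    (hs : s = ⟨C.reg, C.mem, C.pc⟩) :
    ∃ D O C', Exec M P C D O C' ∧ C'.Idle ∧ InOrder D ∧ numRetired D = n := by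
  induction h generalizing C with
  | nil s => exact ⟨[], [], C, .nil C, hC, .nil, rfl⟩
  | cons hstep _ ih =>
    subst hs
    obtain ⟨D, O, C₁, hexec, hC₁, hD, hretired, hcount⟩ := hstep.exists_exec hC
    obtain ⟨T, hrun⟩ := hexec.archRun hP hC hC₁
    rw [hretired] at hrun
    obtain ⟨D', O', C', hexec', hC', hD', hretired'⟩ :=
      ih hC₁ ((ArchRun.single hstep).functional hrun).2
    refine ⟨D ++ D', O ++ O', C', hexec.append hexec', hC', hD.append hD' ?_, ?_⟩
    · rw [hcount, hretired]
    · rw [numRetired, List.countP_append, ← numRetired, ← numRetired, hretired, hretired',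
        add_comm]

theorem InOrder.isSequential (hP : P.NotRead M.rret) (hC : C.Idle) (hD : InOrder D) :
    IsSequential M P C D := by
  intro D₁ D₂ d O C' hsplit hd hexec
  obtain ⟨W, A, hsim⟩ := hexec.simulates hP hC.consistent
  have hcount : W.count + numRetired D₁ ≤ 0 + D₁.countP Directive.isFetch := hsim.count_le
  have := hD D₁ D₂ d hsplit hd
  exact hsim.consistent.idle_iff.2 (by omega)

theorem Exec.exists_seqExec {D₁ : List (Directive V)} {O₁ : List (Obs V L)}
    {C₁ : Config R V L Op} (hP : P.NotRead M.rret) (hC : C.Idle) (h : Exec M P C D₁ O₁ C₁) :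
    ∃ D₂ O₂ C₂, SeqExec M P C D₂ O₂ C₂ ∧ numRetired D₂ = numRetired D₁ := by
  obtain ⟨W, A, hsim⟩ := h.simulates hP hC.consistent
  obtain ⟨D₂, O₂, C₂, hexec, hC₂, hD₂, hretired⟩ := hsim.archRun.exists_exec hP hC rfl
  exact ⟨D₂, O₂, C₂, ⟨hC, hD₂.isSequential hP hC, hexec, hC₂⟩, hretired⟩

end Sequential

end Spec

theorem mainTheorem2 {R V L Op : Type*} [DecidableEq R] [DecidableEq V] [Lattice L] [OrderBot L]
    (M : Spec.Machine R V Op) (P : Spec.Program R V L Op) (hP : P.NotRead M.rret)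
    (ℓ : L)
    (C : Spec.Config R V L Op) (hC : C.Idle)
    (D₁ : List (Spec.Directive V)) (O₁ : List (Spec.Obs V L)) (C₁ : Spec.Config R V L Op)
    (hexec : Spec.Exec M P C D₁ O₁ C₁)
    (hO₁ : ∀ o ∈ O₁, ¬ o.Carries ℓ) :
    (∃ (D₂ : List (Spec.Directive V)) (O₂ : List (Spec.Obs V L)) (C₂ : Spec.Config R V L Op),
      Spec.SeqExec M P C D₂ O₂ C₂ ∧ Spec.numRetired D₂ = Spec.numRetired D₁ ∧
        ∀ o ∈ O₂, ¬ o.Carries ℓ) ∧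
    (∀ (D₂ : List (Spec.Directive V)) (O₂ : List (Spec.Obs V L)) (C₂ : Spec.Config R V L Op),
      Spec.SeqExec M P C D₂ O₂ C₂ → Spec.numRetired D₂ ≤ Spec.numRetired D₁ →
        ∀ o ∈ O₂, ¬ o.Carries ℓ) := by
  have secrecy : ∀ (D₂ : List (Spec.Directive V)) (O₂ : List (Spec.Obs V L))
      (C₂ : Spec.Config R V L Op), Spec.SeqExec M P C D₂ O₂ C₂ →
      Spec.numRetired D₂ ≤ Spec.numRetired D₁ → ∀ o ∈ O₂, ¬ o.Carries ℓ := by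
    intro D₂ O₂ C₂ hseq hn o ho hcarries
    obtain ⟨o', ho', hcarries'⟩ := hseq.obsLabels_subset hP hexec hn ⟨o, ho, hcarries⟩
    exact hO₁ o' ho' hcarries'
  obtain ⟨D₂, O₂, C₂, hseq, hn⟩ := hexec.exists_seqExec hP hC
  exact ⟨⟨D₂, O₂, C₂, hseq, hn, secrecy D₂ O₂ C₂ hseq hn.le⟩, secrecy⟩
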